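/- **Setting.** All Hilbert spaces are finite-dimensional with fixed orthonormal bases, $M_N=B(\mathbb C^N)$, and $\|\cdot\|$ on matrices is the operator norm. A *quantum operation* on $B(\mathcal H)$ is a completely positive trace-preserving linear map $B(\mathcal H)\to B(\mathcal H)$. A *rank-one quantum game* $G=G(|\psi\rangle,|\gamma\rangle)$ is given by unit vectors $|\psi\rangle,|\gamma\rangle\in\mathcal H_A\otimes\mathcal H_B\otimes\mathcal H_C$. The referee prepares $|\psi\rangle$, sends the registers $A$ and $B$ to the players Alice and Bob, receives registers $A$ and $B$ back, and measures $ABC$ with $\{|\gamma\rangle\langle\gamma|,\,1-|\gamma\rangle\langle\gamma|\}$; the players win if the outcome is $|\gamma\rangle\langle\gamma|$. So, if $\rho$ is the final state of $ABC$ and the players' auxiliary system $E$, the winning probability is $\mathrm{tr}\big((|\gamma\rangle\langle\gamma|\otimes 1_E)\rho\big)$. * The *entangled value* $\omega^*(G)$ is the supremum of the winning probability over all finite-dimensional $\mathcal H_{A'},\mathcal H_{B'}$, all shared unit vectors $|\phi\rangle\in\mathcal H_{A'}\otimes\mathcal H_{B'}$ and all quantum operations $T_{AA'}$ on $AA'$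 (Alice) and $T_{BB'}$ on $BB'$ (Bob), applied to $|\psi\rangle|\phi\rangle$. * The *entangled value with one-way communication from Alice to Bob* $\omega_{qow}(G)$ is the supremum of the winning probability over all finite-dimensional $\mathcal H_{A'}\neq 0$, with $A'$ initialized in a fixed basis state $|0\rangle$, and all quantum operations $T_{AA'}$ (applied first, by Alice) and $T_{BA'}$ (applied next, by Bob). * The *maximal value* $V(G)$ is the supremum of the winning probability for a single player holding $A$, $B$ and an arbitrary finite-dimensional auxiliary system $E$ in an arbitrary pure state, who applies an arbitrary quantum operation on $ABE$. **Operator spaces.** For a linear map $T:V\to W$ between operator spaces, $\|T\|_{cb}=\sup_n\|T_n:M_n(V)\to M_n(W)\|$, where $T_n$ acts entrywise; $T$ is a complete contraction if $\|T\|_{cb}\le 1$. $M_N$ has the matrix norms of $M_n(M_N)=M_{nN}$. $R_k$ and $C_k$ are $\mathbb C^k$ with the matrix norms $\|\sum_i A_i\otimes|i\rangle\|=\|\sum_iA_iA_i^*\|^{1/2}$ and $\|\sum_i A_i^*A_i\|^{1/2}$ respectively. $S_1^N$ is the space of $N\times N$ matrices with the operator space structure of the dual $M_N^*$ (where $M_n(V^*)=CB(V,M_n)$)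 under the scalar pairing $\langle b,c\rangle=\sum_{s,t}b_{st}c_{st}$; $S_1^A,S_1^B$ are these spaces for $\mathcal H_A,\mathcal H_B$. For $u\in V\otimes W$, $$\|u\|_{V\otimes_{\min}W}=\sup\big\{\|(T\otimes S)(u)\|_{M_{pq}}:\ p,q\ge1,\ T:V\to M_p,\ S:W\to M_q\text{ complete contractions}\big\},$$ $$\|u\|_{V\otimes_hW}=\inf\Big\{\big\|\textstyle\sum_{i=1}^k|i\rangle\otimes a_i\big\|_{R_k\otimes_{\min}V}\,\big\|\sum_{i=1}^k|i\rangle\otimes b_i\big\|_{C_k\otimes_{\min}W}:\ u=\sum_{i=1}^ka_i\otimes b_i\Big\}.$$ **Theorem.** Let $G=G(|\psi\rangle,|\gamma\rangle)$ be a rank-one quantum game and let $M_{AB}=\mathrm{tr}_C|\psi\rangle\langle\gamma|\in B(\mathcal H_A\otimes\mathcal H_B)=B(\mathcal H_A)\otimes B(\mathcal H_B)$. Then 1. $\omega^*(G)=\|M_{AB}\|^2_{S_1^A\otimes_{\min}S_1^B}$; 2. $\omega_{qow}(G)=\|M_{AB}\|^2_{S_1^A\otimes_hS_1^B}$; 3.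 $V(G)=\|M_{AB}\|^2_{S_1^{AB}}$, where $\|\cdot\|_{S_1^{AB}}$ is the trace norm (sum of singular values) on $B(\mathcal H_A\otimes\mathcal H_B)$. -/

import Mathlib

open scoped ENNReal TensorProduct Kronecker ComplexOrder

noncomputable section

namespace RankOneGames

/-! ### Operator spaces

All Hilbert spaces are finite-dimensional and coordinatized: the space with orthonormal basis
indexed by a finite type `ι` is `EuclideanSpace ℂ ι`, its operators are `Matrix ι ι ℂ`, and the
tensor product of two of them is indexed by the product of the index types.
All norms, suprema and infima are taken in `ℝ≥0∞`, so that none of them has a default value. -/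

/-- The operator norm of a square matrix on the Hilbert space `ℂ^ι`. -/
def opNorm {ι : Type*} [Fintype ι] [DecidableEq ι] (X : Matrix ι ι ℂ) : ℝ≥0∞ :=
  ‖Matrix.toEuclideanCLM (𝕜 := ℂ) X‖ₑ

/-- A sequence of matrix norms on `V`: the data `‖·‖_n` on `M_n(V)`, `n = 0, 1, 2, …`, of an
operator space structure. It is only used for the concrete structures `M_ι`, `R_ι`, `C_ι` and
`S_1^ι` below. -/
abbrev MatrixNorms (V : Type*) := ∀ n : ℕ, Matrix (Fin n) (Fin n) V → ℝ≥0∞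

section General

variable {V W : Type*} [AddCommGroup V] [Module ℂ V] [AddCommGroup W] [Module ℂ W]

/-- The completely bounded norm `sup_n ‖T_n : M_n(V) → M_n(W)‖`. -/
def cbNorm (NV : MatrixNorms V) (NW : MatrixNorms W) (T : V →ₗ[ℂ] W) : ℝ≥0∞ :=
  ⨆ (n : ℕ) (x : Matrix (Fin n) (Fin n) V) (_ : NV n x ≤ 1), NW n (x.map T)

/-- The operator space `M_ι = B(ℂ^ι)`, with `M_n(M_ι) = B(ℂ^n ⊗ ℂ^ι)`. -/
def matNorms (ι : Type*) [Fintype ι] [DecidableEq ι] : MatrixNorms (Matrix ι ι ℂ) :=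
  fun n x => opNorm (Matrix.comp (Fin n) (Fin n) ι ι ℂ x)

/-- The column operator space `C_ι`: `‖∑ i, A i ⊗ |i⟩‖ = ‖∑ i, (A i)ᴴ * A i‖ ^ (1/2)`. -/
def colNorms (ι : Type*) [Fintype ι] : MatrixNorms (ι → ℂ) :=
  fun _ x => opNorm (∑ i, (x.map fun v => v i).conjTranspose * x.map fun v => v i) ^ (1 / 2 : ℝ)

/-- The row operator space `R_ι`: `‖∑ i, A i ⊗ |i⟩‖ = ‖∑ i, A i * (A i)ᴴ‖ ^ (1/2)`. -/
def rowNorms (ι : Type*) [Fintype ι] : MatrixNorms (ι → ℂ) :=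
  fun _ x => opNorm (∑ i, (x.map fun v => v i) * (x.map fun v => v i).conjTranspose) ^ (1 / 2 : ℝ)

/-- The linear map `V → M_n`, `v ↦ (x_ij(v))_ij`, given by a matrix `x` of functionals. -/
def dualMatrixMap {n : ℕ} (x : Matrix (Fin n) (Fin n) (Module.Dual ℂ V)) :
    V →ₗ[ℂ] Matrix (Fin n) (Fin n) ℂ where
  toFun v := Matrix.of fun i j => x i j v
  map_add' u v := by ext; simp
  map_smul' c v := by ext; simp

/-- The dual operator space: `M_n(V^*) = CB(V, M_n)`. -/
def dualNorms (NV : MatrixNorms V) : MatrixNorms (Module.Dual ℂ V) :=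
  fun n x => cbNorm NV (matNorms (Fin n)) (dualMatrixMap x)

/-- The scalar pairing `⟨b, c⟩ = ∑ s t, b s t * c s t = tr (b cᵀ)`. -/
def scalarPairing {ι : Type*} [Fintype ι] (b : Matrix ι ι ℂ) : Module.Dual ℂ (Matrix ι ι ℂ) where
  toFun c := ∑ s, ∑ t, b s t * c s t
  map_add' c d := by simp [mul_add, Finset.sum_add_distrib]
  map_smul' r c := by simp [Finset.mul_sum, mul_left_comm]

/-- The operator space `S_1^ι = (M_ι)^*`, the identification being the scalar pairing. -/
def s1Norms (ι : Type*) [Fintype ι] [DecidableEq ι] : MatrixNorms (Matrix ι ι ℂ) :=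
  fun n x => dualNorms (matNorms ι) n (x.map scalarPairing)

/-- The linear map `v ⊗ w ↦ T v ⊗ S w ∈ B(ℂ^p ⊗ ℂ^q)`. -/
def tensorMap {p q : ℕ} (T : V →ₗ[ℂ] Matrix (Fin p) (Fin p) ℂ)
    (S : W →ₗ[ℂ] Matrix (Fin q) (Fin q) ℂ) :
    V ⊗[ℂ] W →ₗ[ℂ] Matrix (Fin p × Fin q) (Fin p × Fin q) ℂ :=
  TensorProduct.lift ((Matrix.kroneckerMapBilinear (LinearMap.mul ℂ ℂ)).compl₁₂ T S)

/-- The minimal tensor norm: the supremum of `‖(T ⊗ S) u‖` over all complete contractions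
`T : V → M_p` and `S : W → M_q`. -/
def minNorm (NV : MatrixNorms V) (NW : MatrixNorms W) (u : V ⊗[ℂ] W) : ℝ≥0∞ :=
  ⨆ (p : ℕ) (q : ℕ) (T : V →ₗ[ℂ] Matrix (Fin p) (Fin p) ℂ)
    (S : W →ₗ[ℂ] Matrix (Fin q) (Fin q) ℂ)
    (_ : cbNorm NV (matNorms (Fin p)) T ≤ 1) (_ : cbNorm NW (matNorms (Fin q)) S ≤ 1),
    opNorm (tensorMap T S u)

/-- The Haagerup tensor norm: the infimum of
`‖∑ i, |i⟩ ⊗ a i‖_{R_k ⊗_min V} * ‖∑ i, |i⟩ ⊗ b i‖_{C_k ⊗_min W}` over all ways to write `u` as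
`∑ i, a i ⊗ b i`. -/
def haagerupNorm (NV : MatrixNorms V) (NW : MatrixNorms W) (u : V ⊗[ℂ] W) : ℝ≥0∞ :=
  ⨅ (k : ℕ) (a : Fin k → V) (b : Fin k → W) (_ : u = ∑ i, a i ⊗ₜ[ℂ] b i),
    minNorm (rowNorms (Fin k)) NV (∑ i, (Pi.single i 1 : Fin k → ℂ) ⊗ₜ[ℂ] a i) *
      minNorm (colNorms (Fin k)) NW (∑ i, (Pi.single i 1 : Fin k → ℂ) ⊗ₜ[ℂ] b i)

end General

/-- The trace norm (the norm of `S_1`): the sum of the singular values. -/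
def traceNorm {ι : Type*} [Fintype ι] [DecidableEq ι] (X : Matrix ι ι ℂ) : ℝ≥0∞ :=
  ENNReal.ofReal ((Matrix.toEuclideanLin X).singularValues.sum fun _ s => s)

/-- The identification `B(ℂ^α ⊗ ℂ^β) = B(ℂ^α) ⊗ B(ℂ^β)`. -/
def toTensor {α β : Type*} [Fintype α] [Fintype β] [DecidableEq α] [DecidableEq β]
    (X : Matrix (α × β) (α × β) ℂ) : Matrix α α ℂ ⊗[ℂ] Matrix β β ℂ :=
  ∑ i, ∑ j, ∑ k, ∑ l,
    X (i, k) (j, l) • (Matrix.single i j (1 : ℂ) ⊗ₜ[ℂ] Matrix.single k l (1 : ℂ))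

/-! ### Quantum operations -/

/-- The ampliation `T ⊗ id` of a map `T` on `B(ℂ^m)` to `B(ℂ^m ⊗ ℂ^r)`. -/
def ampliate {m r : Type*} (T : Matrix m m ℂ →ₗ[ℂ] Matrix m m ℂ) (X : Matrix (m × r) (m × r) ℂ) :
    Matrix (m × r) (m × r) ℂ :=
  Matrix.of fun x y => T (Matrix.of fun i j => X (i, x.2) (j, y.2)) x.1 y.1

/-- A quantum operation on `B(ℂ^m)`: a completely positive trace-preserving linear map. -/
structure IsQuantumOperation {m : Type*} [Fintype m]
    (T : Matrix m m ℂ →ₗ[ℂ] Matrix m m ℂ) : Prop where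
  completelyPositive : ∀ (n : ℕ) (X : Matrix (m × Fin n) (m × Fin n) ℂ),
    X.PosSemidef → (ampliate T X).PosSemidef
  tracePreserving : ∀ X, (T X).trace = X.trace

/-- `T` acting on the part `m` of a composite system `N ≃ m × r`, the identity on the rest. -/
def applyOn {N m r : Type*} (e : N ≃ m × r) (T : Matrix m m ℂ →ₗ[ℂ] Matrix m m ℂ)
    (X : Matrix N N ℂ) : Matrix N N ℂ :=
  (ampliate T (X.submatrix e.symm e.symm)).submatrix e e

/-- The rank-one operator `|v⟩⟨v|`. -/
def pureState {ι : Type*} (v : EuclideanSpace ℂ ι) : Matrix ι ι ℂ :=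
  Matrix.of fun i j => v i * star (v j)

/-- The vector `|v⟩|w⟩`. -/
def tensorVec {ι κ : Type*} (v : EuclideanSpace ℂ ι) (w : EuclideanSpace ℂ κ) :
    EuclideanSpace ℂ (ι × κ) :=
  WithLp.toLp 2 fun x => v x.1 * w x.2

/-! ### Rank-one quantum games -/

/-- A rank-one quantum game `G(|ψ⟩, |γ⟩)`: an initial state and a measurement state in
`H_A ⊗ H_B ⊗ H_C`. -/
structure Game (α β χ : Type*) [Fintype α] [Fintype β] [Fintype χ] where
  ψ : EuclideanSpace ℂ (α × β × χ)
  γ : EuclideanSpace ℂ (α × β × χ)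
  norm_ψ : ‖ψ‖ = 1
  norm_γ : ‖γ‖ = 1

namespace Game

variable {α β χ : Type*} [Fintype α] [Fintype β] [Fintype χ]

/-- The operator `M_AB = tr_C |ψ⟩⟨γ|`. -/
def M (G : Game α β χ) : Matrix (α × β) (α × β) ℂ :=
  Matrix.of fun x y => ∑ c, G.ψ (x.1, x.2, c) * star (G.γ (y.1, y.2, c))

/-- The probability `tr ((|γ⟩⟨γ| ⊗ 1_E) ρ)` that the final state `ρ` of the registers `ABC`
and the players' auxiliary system `E` passes the referee's measurement. -/
def winProb (G : Game α β χ) {E : Type*} [Fintype E] [DecidableEq E]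
    (ρ : Matrix ((α × β × χ) × E) ((α × β × χ) × E) ℂ) : ℝ :=
  ((pureState G.γ ⊗ₖ (1 : Matrix E E ℂ)) * ρ).trace.re

/-- Alice's system `AA'` inside `(ABC)(A'B')`. -/
def aliceSplit (α β χ P Q : Type*) :
    (α × β × χ) × (P × Q) ≃ (α × P) × (β × χ × Q) where
  toFun x := ((x.1.1, x.2.1), (x.1.2.1, x.1.2.2, x.2.2))
  invFun y := ((y.1.1, y.2.1, y.2.2.1), (y.1.2, y.2.2.2))
  left_inv _ := rfl
  right_inv _ := rfl

/-- Bob's system `BB'` inside `(ABC)(A'B')`. -/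
def bobSplit (α β χ P Q : Type*) :
    (α × β × χ) × (P × Q) ≃ (β × Q) × (α × χ × P) where
  toFun x := ((x.1.2.1, x.2.2), (x.1.1, x.1.2.2, x.2.1))
  invFun y := ((y.2.1, y.1.1, y.2.2.1), (y.2.2.2, y.1.2))
  left_inv _ := rfl
  right_inv _ := rfl

/-- The system `AA'` inside `(ABC)A'`. -/
def senderSplit (α β χ P : Type*) : (α × β × χ) × P ≃ (α × P) × (β × χ) where
  toFun x := ((x.1.1, x.2), (x.1.2.1, x.1.2.2))
  invFun y := ((y.1.1, y.2.1, y.2.2), y.1.2)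
  left_inv _ := rfl
  right_inv _ := rfl

/-- The system `BA'` inside `(ABC)A'`. -/
def receiverSplit (α β χ P : Type*) : (α × β × χ) × P ≃ (β × P) × (α × χ) where
  toFun x := ((x.1.2.1, x.2), (x.1.1, x.1.2.2))
  invFun y := ((y.2.1, y.1.1, y.2.2), y.1.2)
  left_inv _ := rfl
  right_inv _ := rfl

/-- The system `ABE` inside `(ABC)E`. -/
def jointSplit (α β χ E : Type*) : (α × β × χ) × E ≃ (α × β × E) × χ where
  toFun x := ((x.1.1, x.1.2.1, x.2), x.1.2.2)
  invFun y := ((y.1.1, y.1.2.1, y.2), y.1.2.2)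
  left_inv _ := rfl
  right_inv _ := rfl

/-- The entangled value `ω^*(G)`: Alice and Bob share a state `φ ∈ H_A' ⊗ H_B'` and apply quantum
operations to `AA'` and to `BB'`. -/
def entangledValue (G : Game α β χ) : ℝ≥0∞ :=
  ⨆ (p : ℕ) (q : ℕ) (φ : EuclideanSpace ℂ (Fin p × Fin q))
    (T : Matrix (α × Fin p) (α × Fin p) ℂ →ₗ[ℂ] Matrix (α × Fin p) (α × Fin p) ℂ)
    (S : Matrix (β × Fin q) (β × Fin q) ℂ →ₗ[ℂ] Matrix (β × Fin q) (β × Fin q) ℂ)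
    (_ : ‖φ‖ = 1) (_ : IsQuantumOperation T) (_ : IsQuantumOperation S),
    ENNReal.ofReal (G.winProb
      (applyOn (bobSplit α β χ (Fin p) (Fin q)) S
        (applyOn (aliceSplit α β χ (Fin p) (Fin q)) T (pureState (tensorVec G.ψ φ)))))

/-- The entangled value with one-way communication `ω_qow(G)`: the register `A'` starts in the
state `|0⟩`, Alice applies a quantum operation to `AA'` and sends `A'` to Bob, who then applies a
quantum operation to `BA'`. -/
def oneWayValue (G : Game α β χ) : ℝ≥0∞ :=
  ⨆ (p : ℕ)
    (T : Matrix (α × Fin (p + 1)) (α × Fin (p + 1)) ℂ →ₗ[ℂ]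
      Matrix (α × Fin (p + 1)) (α × Fin (p + 1)) ℂ)
    (S : Matrix (β × Fin (p + 1)) (β × Fin (p + 1)) ℂ →ₗ[ℂ]
      Matrix (β × Fin (p + 1)) (β × Fin (p + 1)) ℂ)
    (_ : IsQuantumOperation T) (_ : IsQuantumOperation S),
    ENNReal.ofReal (G.winProb
      (applyOn (receiverSplit α β χ (Fin (p + 1))) S
        (applyOn (senderSplit α β χ (Fin (p + 1))) T
          (pureState (tensorVec G.ψ (EuclideanSpace.single (0 : Fin (p + 1)) (1 : ℂ)))))))

/-- The maximal value `V(G)`: a single player, who holds both registers `A` and `B` and an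
auxiliary system `E` in a state `φ`, applies a quantum operation to `ABE`. -/
def maximalValue (G : Game α β χ) : ℝ≥0∞ :=
  ⨆ (d : ℕ) (φ : EuclideanSpace ℂ (Fin d))
    (T : Matrix (α × β × Fin d) (α × β × Fin d) ℂ →ₗ[ℂ]
      Matrix (α × β × Fin d) (α × β × Fin d) ℂ)
    (_ : ‖φ‖ = 1) (_ : IsQuantumOperation T),
    ENNReal.ofReal (G.winProb
      (applyOn (jointSplit α β χ (Fin d)) T (pureState (tensorVec G.ψ φ))))

end Game

end RankOneGames

end

/-!
The Kraus operators of a player stack up to a contraction. The amplitude of winning along a choice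
of Kraus operators is linear in each of them, so the vector of amplitudes is `M_AB` evaluated on
the linear maps whose block matrices are the transposed stacks. A map `S_1 → M_P` is a complete
contraction exactly when its block matrix `∑ E_st ⊗ T(E_st)` is a contraction of the operator
norm, and every contraction occurs as one of the Kraus operators of some quantum operation. For
two entangled players this is the minimal tensor norm; for a single player it is the duality of
the trace norm and the operator norm.

With one-way communication the amplitudes are sums `∑ i, ⟨M_AB, x i ⊗ y i⟩` over a contractive row
`x` of Alice's operators and a contractive column `y` of Bob's. A Cauchy–Schwarz estimate bounds
them by the value of any decomposition `M_AB = ∑ a k ⊗ b k` in the Haagerup norm. Conversely, if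
`w` strictly bounds all these sums, a Hahn–Banach separation yields positive functionals `f`, `g`
of total mass `2 w` with `2 Re ⟨M_AB, x ⊗ y⟩ ≤ f (x xᴴ) + g (yᴴ y)`.
Represented by positive matrices, slightly perturbed to be invertible, they factor the bilinear form
as `(F ⊗ 1) Λ (1 ⊗ D)` with a contraction `Λ` and Hilbert–Schmidt norms of `F` and `D` of square sum
about `2 w`, and this factorization is a decomposition of `M_AB` of Haagerup value about `w`.
-/

noncomputable section

namespace RankOneGames

open Matrix
open WithLp (toLp)
open scoped Matrix.Norms.L2Operator

/-! ### Operator norms of matrices -/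

section OperatorNorm

variable {𝕜 : Type*} [RCLike 𝕜] {l m n o : Type*} [Fintype l] [Fintype m] [Fintype n] [Fintype o]

section ColumnBounds

variable [DecidableEq n]

theorem l2_opNorm_le_of_forall_mulVec {A : Matrix m n 𝕜} {c : ℝ} (hc : 0 ≤ c)
    (h : ∀ v : EuclideanSpace 𝕜 n, ‖toLp 2 (A *ᵥ v)‖ ≤ c * ‖v‖) : ‖A‖ ≤ c :=
  ContinuousLinearMap.opNorm_le_bound _ hc h

theorem norm_toLp_mulVec_le (A : Matrix m n 𝕜) (v : n → 𝕜) :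
    ‖toLp 2 (A *ᵥ v)‖ ≤ ‖A‖ * ‖toLp 2 v‖ :=
  l2_opNorm_mulVec A (toLp 2 v)

theorem l2_opNorm_one_le : ‖(1 : Matrix n n 𝕜)‖ ≤ 1 :=
  l2_opNorm_le_of_forall_mulVec zero_le_one fun v => by simp

theorem l2_opNorm_le_one_of_conjTranspose_mul_self {A : Matrix m n 𝕜} (h : Aᴴ * A = 1) :
    ‖A‖ ≤ 1 := by
  have h1 : ‖A‖ * ‖A‖ ≤ 1 := by
    rw [← l2_opNorm_conjTranspose_mul_self, h]
    exact l2_opNorm_one_le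
  nlinarith [norm_nonneg A]

theorem l2_opNorm_map_star_le (A : Matrix m n 𝕜) : ‖A.map star‖ ≤ ‖A‖ := by
  refine l2_opNorm_le_of_forall_mulVec (norm_nonneg A) fun v => ?_
  have h : A.map star *ᵥ v = star (A *ᵥ star v.ofLp) := by
    ext i
    simp [mulVec, dotProduct]
  simpa only [h, EuclideanSpace.norm_eq, Pi.star_apply, norm_star] using
    norm_toLp_mulVec_le A (star v.ofLp)

theorem l2_opNorm_map_star (A : Matrix m n 𝕜) : ‖A.map star‖ = ‖A‖ :=
  (l2_opNorm_map_star_le A).antisymm <| by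
    simpa [Function.comp_def] using l2_opNorm_map_star_le (A.map star)

end ColumnBounds

theorem l2_opNorm_transpose [DecidableEq m] [DecidableEq n] (A : Matrix m n 𝕜) : ‖Aᵀ‖ = ‖A‖ := by
  have h : Aᵀ = (A.map star)ᴴ := by
    ext
    simp
  rw [h, l2_opNorm_conjTranspose, l2_opNorm_map_star]

theorem l2_opNorm_mul_mul_le_of_le_one [DecidableEq m] [DecidableEq n] [DecidableEq o]
    {A : Matrix l m 𝕜} {B : Matrix n o 𝕜} (hA : ‖A‖ ≤ 1) (hB : ‖B‖ ≤ 1) (X : Matrix m n 𝕜) :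
    ‖A * X * B‖ ≤ ‖X‖ :=
  calc ‖A * X * B‖ ≤ ‖A‖ * ‖X‖ * ‖B‖ :=
        (l2_opNorm_mul _ _).trans (by gcongr; exact l2_opNorm_mul _ _)
    _ ≤ 1 * ‖X‖ * 1 := by gcongr
    _ = ‖X‖ := by ring

theorem conjTranspose_mul_self_one_submatrix {ι κ : Type*} [DecidableEq ι] [Fintype κ]
    [DecidableEq κ] {f : ι → κ} (hf : f.Injective) :
    ((1 : Matrix κ κ 𝕜).submatrix id f)ᴴ * (1 : Matrix κ κ 𝕜).submatrix id f = 1 := by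
  ext i j
  simp [Matrix.mul_apply, Matrix.one_apply, hf.eq_iff, eq_comm]

theorem l2_opNorm_one_submatrix_le [DecidableEq m] [DecidableEq n] {f : n → m}
    (hf : f.Injective) : ‖(1 : Matrix m m 𝕜).submatrix id f‖ ≤ 1 :=
  l2_opNorm_le_one_of_conjTranspose_mul_self (conjTranspose_mul_self_one_submatrix hf)

section Submatrix

variable [DecidableEq n] [DecidableEq o]

theorem l2_opNorm_submatrix_le (A : Matrix m n 𝕜) {f : l → m} {g : o → n} (hf : f.Injective)
    (hg : g.Injective) : ‖A.submatrix f g‖ ≤ ‖A‖ := by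
  classical
  have h : A.submatrix f g =
      ((1 : Matrix m m 𝕜).submatrix id f)ᴴ * A * (1 : Matrix n n 𝕜).submatrix id g := by
    ext i j
    simp [Matrix.mul_apply, Matrix.one_apply]
  rw [h]
  refine l2_opNorm_mul_mul_le_of_le_one ?_ (l2_opNorm_one_submatrix_le hg) A
  rw [l2_opNorm_conjTranspose]
  exact l2_opNorm_one_submatrix_le hf

theorem l2_opNorm_submatrix_equiv (A : Matrix m n 𝕜) (e : l ≃ m) (f : o ≃ n) :
    ‖A.submatrix e f‖ = ‖A‖ :=
  (l2_opNorm_submatrix_le A e.injective f.injective).antisymm <| by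
    simpa [submatrix_submatrix] using
      l2_opNorm_submatrix_le (A.submatrix e f) e.symm.injective f.symm.injective

end Submatrix

section Kronecker

variable [DecidableEq n]

theorem l2_opNorm_one_kronecker_le [DecidableEq l] (A : Matrix m n 𝕜) :
    ‖(1 : Matrix l l 𝕜) ⊗ₖ A‖ ≤ ‖A‖ := by
  refine l2_opNorm_le_of_forall_mulVec (norm_nonneg A) fun v => ?_
  have h (i : l) (j : m) : (((1 : Matrix l l 𝕜) ⊗ₖ A) *ᵥ v.ofLp) (i, j) =
      (A *ᵥ fun k => v (i, k)) j := by
    simp [mulVec, dotProduct, Fintype.sum_prod_type, Matrix.one_apply]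
  rw [← sq_le_sq₀ (norm_nonneg _) (by positivity), mul_pow, EuclideanSpace.norm_sq_eq,
    EuclideanSpace.norm_sq_eq, Fintype.sum_prod_type, Fintype.sum_prod_type, Finset.mul_sum]
  refine Finset.sum_le_sum fun i _ => ?_
  simpa only [h, mul_pow, EuclideanSpace.norm_sq_eq] using
    pow_le_pow_left₀ (norm_nonneg _) (norm_toLp_mulVec_le A fun k => v (i, k)) 2

theorem l2_opNorm_kronecker_one_le [DecidableEq l] (A : Matrix m n 𝕜) :
    ‖A ⊗ₖ (1 : Matrix l l 𝕜)‖ ≤ ‖A‖ := by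
  have h : A ⊗ₖ (1 : Matrix l l 𝕜) =
      ((1 : Matrix l l 𝕜) ⊗ₖ A).submatrix (Equiv.prodComm _ _) (Equiv.prodComm _ _) := by
    ext ⟨i, k⟩ ⟨j, k'⟩
    simp [mul_comm]
  rw [h, l2_opNorm_submatrix_equiv]
  exact l2_opNorm_one_kronecker_le A

theorem l2_opNorm_kronecker_le [DecidableEq l] (A : Matrix m n 𝕜) (B : Matrix o l 𝕜) :
    ‖A ⊗ₖ B‖ ≤ ‖A‖ * ‖B‖ := by
  classical
  calc ‖A ⊗ₖ B‖ = ‖(A ⊗ₖ (1 : Matrix o o 𝕜)) * ((1 : Matrix n n 𝕜) ⊗ₖ B)‖ := by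
        rw [← mul_kronecker_mul, Matrix.mul_one, Matrix.one_mul]
    _ ≤ ‖A ⊗ₖ (1 : Matrix o o 𝕜)‖ * ‖(1 : Matrix n n 𝕜) ⊗ₖ B‖ := l2_opNorm_mul _ _
    _ ≤ ‖A‖ * ‖B‖ := by
        gcongr
        exacts [l2_opNorm_kronecker_one_le A, l2_opNorm_one_kronecker_le B]

end Kronecker

end OperatorNorm

section Stack

variable {𝕜 : Type*} [RCLike 𝕜] {ι m n : Type*}

/-- The block column of a family of matrices, with row index `(row of A i, i)`. -/
def colStack (A : ι → Matrix m n 𝕜) : Matrix (m × ι) n 𝕜 :=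
  Matrix.of fun x j => A x.2 x.1 j

/-- The block row of a family of matrices, with column index `(column of A i, i)`. -/
def rowStack (A : ι → Matrix m n 𝕜) : Matrix m (n × ι) 𝕜 :=
  Matrix.of fun i y => A y.2 i y.1

theorem conjTranspose_rowStack (A : ι → Matrix m n 𝕜) :
    (rowStack A)ᴴ = colStack fun i => (A i)ᴴ := rfl

theorem colStack_smul (c : 𝕜) (A : ι → Matrix m n 𝕜) :
    (colStack fun i => c • A i) = c • colStack A := rfl

theorem rowStack_smul (c : 𝕜) (A : ι → Matrix m n 𝕜) :
    (rowStack fun i => c • A i) = c • rowStack A := rfl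

variable [Fintype ι] [Fintype m]

theorem conjTranspose_colStack_mul_self (A : ι → Matrix m n 𝕜) :
    (colStack A)ᴴ * colStack A = ∑ i, (A i)ᴴ * A i := by
  ext j k
  simp [Matrix.mul_apply, colStack, Matrix.sum_apply, Fintype.sum_prod_type_right]

variable [Fintype n]

theorem l2_opNorm_colStack_sq [DecidableEq n] (A : ι → Matrix m n 𝕜) :
    ‖colStack A‖ ^ 2 = ‖∑ i, (A i)ᴴ * A i‖ := by
  rw [← conjTranspose_colStack_mul_self, l2_opNorm_conjTranspose_mul_self, sq]

theorem l2_opNorm_rowStack_sq [DecidableEq ι] [DecidableEq m] [DecidableEq n]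
    (A : ι → Matrix m n 𝕜) : ‖rowStack A‖ ^ 2 = ‖∑ i, A i * (A i)ᴴ‖ := by
  rw [← l2_opNorm_conjTranspose, conjTranspose_rowStack, l2_opNorm_colStack_sq]
  simp

theorem norm_sq_colStack_mulVec (A : ι → Matrix m n 𝕜) (v : n → 𝕜) :
    ‖toLp 2 (colStack A *ᵥ v)‖ ^ 2 = ∑ i, ‖toLp 2 (A i *ᵥ v)‖ ^ 2 := by
  simp only [EuclideanSpace.norm_sq_eq, Fintype.sum_prod_type_right]
  rfl

theorem l2_opNorm_sum_smul_le [DecidableEq n] (t : EuclideanSpace 𝕜 ι) (W : ι → Matrix m n 𝕜) :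
    ‖∑ i, t i • W i‖ ≤ ‖t‖ * ‖colStack W‖ := by
  refine l2_opNorm_le_of_forall_mulVec (by positivity) fun v => ?_
  have h : toLp 2 ((∑ i, t i • W i) *ᵥ v.ofLp) = ∑ i, t i • toLp 2 (W i *ᵥ v.ofLp) := by
    simp only [sum_mulVec, smul_mulVec, WithLp.toLp_sum, WithLp.toLp_smul]
  calc ‖toLp 2 ((∑ i, t i • W i) *ᵥ v.ofLp)‖ ≤ ∑ i, ‖t i‖ * ‖toLp 2 (W i *ᵥ v.ofLp)‖ := by
        rw [h]
        exact (norm_sum_le _ _).trans_eq (by simp only [norm_smul])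
    _ ≤ √(∑ i, ‖t i‖ ^ 2) * √(∑ i, ‖toLp 2 (W i *ᵥ v.ofLp)‖ ^ 2) :=
        Real.sum_mul_le_sqrt_mul_sqrt _ _ _
    _ = ‖t‖ * ‖toLp 2 (colStack W *ᵥ v.ofLp)‖ := by
        rw [← norm_sq_colStack_mulVec, Real.sqrt_sq (norm_nonneg _), ← EuclideanSpace.norm_eq]
    _ ≤ ‖t‖ * ‖colStack W‖ * ‖v‖ := by
        rw [mul_assoc]
        gcongr
        exact norm_toLp_mulVec_le _ _

theorem l2_opNorm_colStack_sum_smul_le {κ : Type*} [Fintype κ] [DecidableEq κ] [DecidableEq n]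
    (Λ : Matrix ι κ 𝕜) (W : κ → Matrix m n 𝕜) :
    ‖colStack fun i => ∑ j, Λ i j • W j‖ ≤ ‖Λ‖ * ‖colStack W‖ := by
  classical
  have h : (colStack fun i => ∑ j, Λ i j • W j) = ((1 : Matrix m m 𝕜) ⊗ₖ Λ) * colStack W := by
    ext ⟨p, i⟩ q
    simp [colStack, Matrix.mul_apply, Fintype.sum_prod_type, Matrix.sum_apply, Matrix.one_apply]
  rw [h]
  exact (l2_opNorm_mul _ _).trans (by gcongr; exact l2_opNorm_one_kronecker_le Λ)

theorem l2_opNorm_colStack_smul_one_le [DecidableEq n] (c : EuclideanSpace 𝕜 ι) :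
    ‖colStack fun i => c i • (1 : Matrix n n 𝕜)‖ ≤ ‖c‖ := by
  rw [← sq_le_sq₀ (norm_nonneg _) (norm_nonneg _), l2_opNorm_colStack_sq]
  have h : ∑ i, (c i • (1 : Matrix n n 𝕜))ᴴ * c i • (1 : Matrix n n 𝕜) =
      ((‖c‖ ^ 2 : ℝ) : 𝕜) • (1 : Matrix n n 𝕜) := by
    simp [EuclideanSpace.norm_sq_eq, Finset.sum_smul, smul_smul, RCLike.mul_conj]
  rw [h, norm_smul, RCLike.norm_ofReal, abs_of_nonneg (by positivity)]
  exact mul_le_of_le_one_right (by positivity) l2_opNorm_one_le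

theorem l2_opNorm_rowStack_transpose [DecidableEq ι] [DecidableEq m] [DecidableEq n]
    (A : ι → Matrix m n 𝕜) : ‖rowStack fun i => (A i)ᵀ‖ = ‖colStack A‖ :=
  l2_opNorm_transpose (colStack A)

theorem l2_opNorm_rowStack_comp_equiv {κ : Type*} [Fintype κ] [DecidableEq ι] [DecidableEq κ]
    [DecidableEq n] (A : ι → Matrix m n 𝕜) (e : κ ≃ ι) : ‖rowStack (A ∘ e)‖ = ‖rowStack A‖ :=
  l2_opNorm_submatrix_equiv (rowStack A) (.refl m) ((Equiv.refl n).prodCongr e)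

theorem l2_opNorm_colStack_comp_equiv {κ : Type*} [Fintype κ] [DecidableEq n]
    (A : ι → Matrix m n 𝕜) (e : κ ≃ ι) : ‖colStack (A ∘ e)‖ = ‖colStack A‖ :=
  l2_opNorm_submatrix_equiv (colStack A) ((Equiv.refl m).prodCongr e) (.refl n)

end Stack

/-! ### Complete contractions -/

theorem opNorm_eq_enorm {ι : Type*} [Fintype ι] [DecidableEq ι] (X : Matrix ι ι ℂ) :
    opNorm X = ‖X‖ₑ := rfl

theorem opNorm_le_one_iff {ι : Type*} [Fintype ι] [DecidableEq ι] {X : Matrix ι ι ℂ} :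
    opNorm X ≤ 1 ↔ ‖X‖ ≤ 1 := by
  rw [opNorm_eq_enorm, ← ofReal_norm, ENNReal.ofReal_le_one]

section CompleteContraction

variable {V W : Type*} [AddCommGroup V] [Module ℂ V] [AddCommGroup W] [Module ℂ W]
variable {P P' Q Q' : Type*}

/-- The linear map `v ⊗ w ↦ T v ⊗ S w`, as `tensorMap` but for maps into rectangular matrices with
arbitrary index types. -/
def rectTensorMap (T : V →ₗ[ℂ] Matrix P P' ℂ) (S : W →ₗ[ℂ] Matrix Q Q' ℂ) :
    V ⊗[ℂ] W →ₗ[ℂ] Matrix (P × Q) (P' × Q') ℂ :=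
  TensorProduct.lift ((kroneckerMapBilinear (LinearMap.mul ℂ ℂ)).compl₁₂ T S)

theorem rectTensorMap_tmul (T : V →ₗ[ℂ] Matrix P P' ℂ) (S : W →ₗ[ℂ] Matrix Q Q' ℂ) (v : V)
    (w : W) : rectTensorMap T S (v ⊗ₜ w) = T v ⊗ₖ S w := by
  ext
  simp [rectTensorMap]

theorem tensorMap_eq_rectTensorMap {p q : ℕ} (T : V →ₗ[ℂ] Matrix (Fin p) (Fin p) ℂ)
    (S : W →ₗ[ℂ] Matrix (Fin q) (Fin q) ℂ) : tensorMap T S = rectTensorMap T S := rfl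

variable [Fintype P] [Fintype P'] [Fintype Q] [Fintype Q']

/-- The map `v ↦ A * T v * B`. -/
def sandwich {N N' : Type*} (A : Matrix N P ℂ) (T : V →ₗ[ℂ] Matrix P P' ℂ) (B : Matrix P' N' ℂ) :
    V →ₗ[ℂ] Matrix N N' ℂ where
  toFun v := A * T v * B
  map_add' u v := by simp [Matrix.mul_add, Matrix.add_mul]
  map_smul' c v := by simp

theorem rectTensorMap_sandwich {N N' M M' : Type*} (A : Matrix N P ℂ) (T : V →ₗ[ℂ] Matrix P P' ℂ)
    (B : Matrix P' N' ℂ) (C : Matrix M Q ℂ) (S : W →ₗ[ℂ] Matrix Q Q' ℂ) (D : Matrix Q' M' ℂ)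
    (u : V ⊗[ℂ] W) :
    rectTensorMap (sandwich A T B) (sandwich C S D) u =
      (A ⊗ₖ C) * rectTensorMap T S u * (B ⊗ₖ D) := by
  induction u with
  | zero => simp
  | tmul v w => simp [rectTensorMap_tmul, sandwich, mul_kronecker_mul]
  | add u v hu hv => rw [map_add, map_add, hu, hv, Matrix.mul_add, Matrix.add_mul]

theorem sandwich_conjTranspose_sandwich [DecidableEq P] [DecidableEq P'] {N N' : Type*}
    [Fintype N] [Fintype N'] {A : Matrix N P ℂ} {B : Matrix N' P' ℂ} (hA : Aᴴ * A = 1)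
    (hB : Bᴴ * B = 1) (T : V →ₗ[ℂ] Matrix P P' ℂ) : sandwich Aᴴ (sandwich A T Bᴴ) B = T := by
  ext1 v
  calc Aᴴ * (A * T v * Bᴴ) * B = (Aᴴ * A) * T v * (Bᴴ * B) := by simp only [Matrix.mul_assoc]
    _ = T v := by rw [hA, hB, Matrix.one_mul, Matrix.mul_one]

variable [DecidableEq P'] [DecidableEq Q']

/-- `T : V → M_{P,P'}` is a complete contraction; the target may consist of rectangular
matrices. -/
def IsCompleteContraction (NV : MatrixNorms V) (T : V →ₗ[ℂ] Matrix P P' ℂ) : Prop :=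
  ∀ (n : ℕ) (x : Matrix (Fin n) (Fin n) V), NV n x ≤ 1 →
    ‖Matrix.comp (Fin n) (Fin n) P P' ℂ (x.map T)‖ ≤ 1

theorem cbNorm_le_one_iff [DecidableEq P] {NV : MatrixNorms V} {T : V →ₗ[ℂ] Matrix P P ℂ} :
    cbNorm NV (matNorms P) T ≤ 1 ↔ IsCompleteContraction NV T := by
  simp only [cbNorm, matNorms, iSup_le_iff, opNorm_le_one_iff, IsCompleteContraction]

theorem IsCompleteContraction.sandwich {N N' : Type*} [Fintype N] [Fintype N'] [DecidableEq P]
    [DecidableEq N'] {NV : MatrixNorms V} {T : V →ₗ[ℂ] Matrix P P' ℂ}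
    (hT : IsCompleteContraction NV T) {A : Matrix N P ℂ} {B : Matrix P' N' ℂ} (hA : ‖A‖ ≤ 1)
    (hB : ‖B‖ ≤ 1) : IsCompleteContraction NV (sandwich A T B) := by
  intro n x hx
  have h : Matrix.comp _ _ _ _ ℂ (x.map (RankOneGames.sandwich A T B)) =
      ((1 : Matrix (Fin n) (Fin n) ℂ) ⊗ₖ A) * Matrix.comp _ _ _ _ ℂ (x.map T) *
        ((1 : Matrix (Fin n) (Fin n) ℂ) ⊗ₖ B) := by
    ext ⟨i, p⟩ ⟨j, q⟩
    simp [RankOneGames.sandwich, Matrix.mul_apply, Matrix.one_apply, Fintype.sum_prod_type]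
  rw [h]
  exact (l2_opNorm_mul_mul_le_of_le_one ((l2_opNorm_one_kronecker_le A).trans hA)
    ((l2_opNorm_one_kronecker_le B).trans hB) _).trans (hT n x hx)

theorem exists_isometries_into_fin (R R' : Type*) [Finite R] [Finite R'] [DecidableEq R]
    [DecidableEq R'] :
    ∃ (N : ℕ) (A : Matrix (Fin N) R ℂ) (B : Matrix (Fin N) R' ℂ), Aᴴ * A = 1 ∧ Bᴴ * B = 1 :=
  let e := Finite.equivFin (R ⊕ R')
  ⟨_, _, _, conjTranspose_mul_self_one_submatrix (e.injective.comp Sum.inl_injective),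
    conjTranspose_mul_self_one_submatrix (e.injective.comp Sum.inr_injective)⟩

/-- Composing with isometries turns rectangular values into square ones. -/
theorem enorm_rectTensorMap_le_minNorm {NV : MatrixNorms V} {NW : MatrixNorms W}
    {T : V →ₗ[ℂ] Matrix P P' ℂ} {S : W →ₗ[ℂ] Matrix Q Q' ℂ} (hT : IsCompleteContraction NV T)
    (hS : IsCompleteContraction NW S) (u : V ⊗[ℂ] W) :
    ‖rectTensorMap T S u‖ₑ ≤ minNorm NV NW u := by
  classical
  obtain ⟨p, A, B, hA, hB⟩ := exists_isometries_into_fin P P'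
  obtain ⟨q, C, D, hC, hD⟩ := exists_isometries_into_fin Q Q'
  have hA' := l2_opNorm_le_one_of_conjTranspose_mul_self hA
  have hB' := l2_opNorm_le_one_of_conjTranspose_mul_self hB
  have hC' := l2_opNorm_le_one_of_conjTranspose_mul_self hC
  have hD' := l2_opNorm_le_one_of_conjTranspose_mul_self hD
  have h : rectTensorMap T S u = (A ⊗ₖ C)ᴴ * tensorMap (sandwich A T Bᴴ) (sandwich C S Dᴴ) u *
      (B ⊗ₖ D) := by
    rw [tensorMap_eq_rectTensorMap, conjTranspose_kronecker, ← rectTensorMap_sandwich,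
      sandwich_conjTranspose_sandwich hA hB, sandwich_conjTranspose_sandwich hC hD]
  calc ‖rectTensorMap T S u‖ₑ ≤ opNorm (tensorMap (sandwich A T Bᴴ) (sandwich C S Dᴴ) u) := by
        rw [opNorm_eq_enorm, enorm_le_iff_norm_le, h]
        refine l2_opNorm_mul_mul_le_of_le_one ?_ ?_ _
        · rw [l2_opNorm_conjTranspose]
          exact (l2_opNorm_kronecker_le A C).trans (mul_le_one₀ hA' (norm_nonneg _) hC')
        · exact (l2_opNorm_kronecker_le B D).trans (mul_le_one₀ hB' (norm_nonneg _) hD')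
    _ ≤ minNorm NV NW u :=
        le_iSup_of_le p <| le_iSup_of_le q <| le_iSup_of_le _ <| le_iSup_of_le _ <|
          le_iSup_of_le (cbNorm_le_one_iff.mpr (hT.sandwich hA' (by rwa [l2_opNorm_conjTranspose])))
          <| le_iSup_of_le
            (cbNorm_le_one_iff.mpr (hS.sandwich hC' (by rwa [l2_opNorm_conjTranspose]))) le_rfl

end CompleteContraction

section TraceClass

variable {α : Type*} [Fintype α] [DecidableEq α] {P P' : Type*}

/-- The block matrix `∑ E_st ⊗ T(E_st)` of a map on `S_1`, where `E_st` are the matrix units. -/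
def blockMatrix (T : Matrix α α ℂ →ₗ[ℂ] Matrix P P' ℂ) : Matrix (α × P) (α × P') ℂ :=
  Matrix.of fun x y => T (Matrix.single x.1 y.1 1) x.2 y.2

/-- The map `c ↦ ∑ c_st X_st` on `S_1` with block matrix `X`. -/
def ofBlockMatrix (X : Matrix (α × P) (α × P') ℂ) : Matrix α α ℂ →ₗ[ℂ] Matrix P P' ℂ where
  toFun c := Matrix.of fun p q => ∑ s, ∑ t, c s t * X (s, p) (t, q)
  map_add' c d := by ext; simp [add_mul, Finset.sum_add_distrib]
  map_smul' r c := by ext; simp [Finset.mul_sum, mul_assoc]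

theorem map_apply_eq_sum_blockMatrix (T : Matrix α α ℂ →ₗ[ℂ] Matrix P P' ℂ) (c : Matrix α α ℂ)
    (p : P) (q : P') : T c p q = ∑ s, ∑ t, c s t * blockMatrix T (s, p) (t, q) := by
  have h (s t : α) : Matrix.single s t (c s t) = c s t • Matrix.single s t (1 : ℂ) := by simp
  conv_lhs => rw [Matrix.matrix_eq_sum_single c]
  simp only [h, map_sum, Matrix.sum_apply, map_smul, Matrix.smul_apply, blockMatrix,
    Matrix.of_apply, smul_eq_mul]

theorem blockMatrix_ofBlockMatrix (X : Matrix (α × P) (α × P') ℂ) :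
    blockMatrix (ofBlockMatrix X) = X := by
  ext ⟨s, p⟩ ⟨t, q⟩
  simp [blockMatrix, ofBlockMatrix, Matrix.single_apply, ite_and]

theorem ofBlockMatrix_blockMatrix (T : Matrix α α ℂ →ₗ[ℂ] Matrix P P' ℂ) :
    ofBlockMatrix (blockMatrix T) = T := by
  ext1 c
  ext p q
  exact (map_apply_eq_sum_blockMatrix T c p q).symm

theorem blockMatrix_sandwich [Fintype P] [Fintype P'] {N N' : Type*} (A : Matrix N P ℂ)
    (T : Matrix α α ℂ →ₗ[ℂ] Matrix P P' ℂ) (B : Matrix P' N' ℂ) :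
    blockMatrix (sandwich A T B) =
      ((1 : Matrix α α ℂ) ⊗ₖ A) * blockMatrix T * ((1 : Matrix α α ℂ) ⊗ₖ B) := by
  ext ⟨i, p⟩ ⟨j, q⟩
  simp [blockMatrix, sandwich, Matrix.mul_apply, Matrix.one_apply, Fintype.sum_prod_type]

theorem s1Norms_le_one_iff {n : ℕ} {x : Matrix (Fin n) (Fin n) (Matrix α α ℂ)} :
    s1Norms α n x ≤ 1 ↔ IsCompleteContraction (matNorms α) (dualMatrixMap (x.map scalarPairing)) :=
  cbNorm_le_one_iff

/-- The entries of `x ∈ M_n(S_1)` evaluated at those of `blockMatrix T ∈ M_N(M_α)` form, up to the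
flip, the amplification of `T` evaluated at `x`. -/
theorem isCompleteContraction_s1Norms_of_fin {N : ℕ}
    {T : Matrix α α ℂ →ₗ[ℂ] Matrix (Fin N) (Fin N) ℂ} (h : ‖blockMatrix T‖ ≤ 1) :
    IsCompleteContraction (s1Norms α) T := by
  intro n x hx
  let y : Matrix (Fin N) (Fin N) (Matrix α α ℂ) :=
    Matrix.of fun p q => Matrix.of fun s t => blockMatrix T (s, p) (t, q)
  have hy : matNorms α N y ≤ 1 := by
    rw [matNorms, opNorm_le_one_iff]
    exact (l2_opNorm_submatrix_equiv (blockMatrix T) (.prodComm _ _) (.prodComm _ _)).trans_le h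
  have hxy := s1Norms_le_one_iff.mp hx N y hy
  rw [← l2_opNorm_submatrix_equiv _ (.prodComm _ _) (.prodComm _ _)] at hxy
  convert hxy using 2
  ext ⟨i, p⟩ ⟨j, q⟩
  simp [y, dualMatrixMap, scalarPairing, map_apply_eq_sum_blockMatrix]

theorem rectTensorMap_toTensor {β Q Q' : Type*} [Fintype β] [DecidableEq β]
    (T : Matrix α α ℂ →ₗ[ℂ] Matrix P P' ℂ) (S : Matrix β β ℂ →ₗ[ℂ] Matrix Q Q' ℂ)
    (X : Matrix (α × β) (α × β) ℂ) (x : P × Q) (y : P' × Q') :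
    rectTensorMap T S (toTensor X) x y =
      ∑ a, ∑ a', ∑ b, ∑ b', X (a, b) (a', b') *
        (blockMatrix T (a, x.1) (a', y.1) * blockMatrix S (b, x.2) (b', y.2)) := by
  simp only [toTensor, map_sum, Matrix.sum_apply, map_smul, Matrix.smul_apply, rectTensorMap_tmul,
    kroneckerMap_apply, blockMatrix, Matrix.of_apply, smul_eq_mul]

variable [Fintype P] [Fintype P'] [DecidableEq P']

theorem isCompleteContraction_s1Norms_of_blockMatrix {T : Matrix α α ℂ →ₗ[ℂ] Matrix P P' ℂ}
    (h : ‖blockMatrix T‖ ≤ 1) : IsCompleteContraction (s1Norms α) T := by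
  classical
  obtain ⟨N, A, B, hA, hB⟩ := exists_isometries_into_fin P P'
  have hA' := l2_opNorm_le_one_of_conjTranspose_mul_self hA
  have hB' := l2_opNorm_le_one_of_conjTranspose_mul_self hB
  rw [← sandwich_conjTranspose_sandwich hA hB T]
  refine (isCompleteContraction_s1Norms_of_fin ?_).sandwich (by rwa [l2_opNorm_conjTranspose]) hB'
  rw [blockMatrix_sandwich]
  refine (l2_opNorm_mul_mul_le_of_le_one ?_ ?_ _).trans h
  · exact (l2_opNorm_one_kronecker_le A).trans hA'
  · exact (l2_opNorm_one_kronecker_le _).trans (by rwa [l2_opNorm_conjTranspose])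

/-- Evaluate `T` at the matrix of matrix units, a norm one element of `M_α(S_1)`. -/
theorem IsCompleteContraction.norm_blockMatrix_le {T : Matrix α α ℂ →ₗ[ℂ] Matrix P P' ℂ}
    (h : IsCompleteContraction (s1Norms α) T) : ‖blockMatrix T‖ ≤ 1 := by
  let e := Fintype.equivFin α
  let x : Matrix (Fin (Fintype.card α)) (Fin (Fintype.card α)) (Matrix α α ℂ) :=
    Matrix.of fun i j => Matrix.single (e.symm i) (e.symm j) 1
  have hx : s1Norms α _ x ≤ 1 := by
    rw [s1Norms_le_one_iff]
    intro n y hy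
    rw [matNorms, opNorm_le_one_iff,
      ← l2_opNorm_submatrix_equiv _ ((Equiv.refl _).prodCongr e.symm)
        ((Equiv.refl _).prodCongr e.symm)] at hy
    convert hy using 2
    ext ⟨i, p⟩ ⟨j, q⟩
    simp [x, dualMatrixMap, scalarPairing, Matrix.single_apply, ite_and]
  have hTx := h _ x hx
  rw [← l2_opNorm_submatrix_equiv _ (e.prodCongr (.refl _)) (e.prodCongr (.refl _))] at hTx
  convert hTx using 2
  ext ⟨i, p⟩ ⟨j, q⟩
  simp [x, blockMatrix]

end TraceClass

section RowColumn

variable {κ : Type*} [Fintype κ]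

theorem opNorm_rpow_half_le_one_iff {ι : Type*} [Fintype ι] [DecidableEq ι] {X : Matrix ι ι ℂ}
    {c : ℝ} (hc : 0 ≤ c) (h : c ^ 2 = ‖X‖) : opNorm X ^ (1 / 2 : ℝ) ≤ 1 ↔ c ≤ 1 := by
  rw [one_div, ENNReal.rpow_inv_le_iff two_pos, ENNReal.one_rpow, opNorm_le_one_iff, ← h,
    sq_le_one_iff₀ hc]

theorem rowNorms_le_one_iff [DecidableEq κ] {n : ℕ} {x : Matrix (Fin n) (Fin n) (κ → ℂ)} :
    rowNorms κ n x ≤ 1 ↔ ‖rowStack fun i => x.map fun v => v i‖ ≤ 1 :=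
  opNorm_rpow_half_le_one_iff (norm_nonneg _) (l2_opNorm_rowStack_sq _)

theorem colNorms_le_one_iff {n : ℕ} {x : Matrix (Fin n) (Fin n) (κ → ℂ)} :
    colNorms κ n x ≤ 1 ↔ ‖colStack fun i => x.map fun v => v i‖ ≤ 1 :=
  opNorm_rpow_half_le_one_iff (norm_nonneg _) (l2_opNorm_colStack_sq _)

/-- The embedding of `R_κ` as matrices with one row. -/
def rowMap (κ : Type*) : (κ → ℂ) →ₗ[ℂ] Matrix Unit κ ℂ where
  toFun := replicateRow Unit
  map_add' _ _ := rfl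
  map_smul' _ _ := rfl

/-- The embedding of `C_κ` as matrices with one column. -/
def colMap (κ : Type*) : (κ → ℂ) →ₗ[ℂ] Matrix κ Unit ℂ where
  toFun := replicateCol Unit
  map_add' _ _ := rfl
  map_smul' _ _ := rfl

@[simp]
theorem rowMap_apply {κ : Type*} (v : κ → ℂ) (u : Unit) (k : κ) : rowMap κ v u k = v k := rfl

@[simp]
theorem colMap_apply {κ : Type*} (v : κ → ℂ) (k : κ) (u : Unit) : colMap κ v k u = v k := rfl

theorem isCompleteContraction_rowMap [DecidableEq κ] :
    IsCompleteContraction (rowNorms κ) (rowMap κ) := by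
  intro n x hx
  rw [rowNorms_le_one_iff, ← l2_opNorm_submatrix_equiv _ (.prodPUnit _) (.refl _)] at hx
  exact hx

theorem isCompleteContraction_colMap : IsCompleteContraction (colNorms κ) (colMap κ) := by
  intro n x hx
  rw [colNorms_le_one_iff, ← l2_opNorm_submatrix_equiv _ (.refl _) (.prodPUnit _)] at hx
  exact hx

variable [DecidableEq κ] {W : Type*} [AddCommGroup W] [Module ℂ W] {NW : MatrixNorms W}

section LowerBound

variable {Q Q' : Type*} [Fintype Q] [Fintype Q'] [DecidableEq Q'] {S : W →ₗ[ℂ] Matrix Q Q' ℂ}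

theorem enorm_rowStack_le_minNorm (hS : IsCompleteContraction NW S) (a : κ → W) :
    ‖rowStack fun i => S (a i)‖ₑ ≤
      minNorm (rowNorms κ) NW (∑ i, (Pi.single i 1 : κ → ℂ) ⊗ₜ[ℂ] a i) := by
  refine le_of_eq_of_le ?_ (enorm_rectTensorMap_le_minNorm isCompleteContraction_rowMap hS _)
  rw [← ofReal_norm, ← ofReal_norm, ← l2_opNorm_submatrix_equiv (rectTensorMap _ _ _)
    (Equiv.punitProd _).symm (.prodComm _ _)]
  congr 2
  ext i ⟨j, k⟩
  simp [rowStack, rectTensorMap_tmul, Matrix.sum_apply, Pi.single_apply]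

theorem enorm_colStack_le_minNorm (hS : IsCompleteContraction NW S) (a : κ → W) :
    ‖colStack fun i => S (a i)‖ₑ ≤
      minNorm (colNorms κ) NW (∑ i, (Pi.single i 1 : κ → ℂ) ⊗ₜ[ℂ] a i) := by
  refine le_of_eq_of_le ?_ (enorm_rectTensorMap_le_minNorm isCompleteContraction_colMap hS _)
  rw [← ofReal_norm, ← ofReal_norm, ← l2_opNorm_submatrix_equiv (rectTensorMap _ _ _)
    (.prodComm _ _) (Equiv.punitProd _).symm]
  congr 2
  ext ⟨j, k⟩ i
  simp [colStack, rectTensorMap_tmul, Matrix.sum_apply, Pi.single_apply]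

end LowerBound

section UpperBound

variable {c : ℝ}

theorem minNorm_sum_single_tmul_le {N : MatrixNorms (κ → ℂ)} (hc : 0 < c) {a : κ → W}
    (h : ∀ (q : ℕ) (S : W →ₗ[ℂ] Matrix (Fin q) (Fin q) ℂ), IsCompleteContraction NW S →
      N q (Matrix.of fun r s i => (c : ℂ)⁻¹ * S (a i) r s) ≤ 1) :
    minNorm N NW (∑ i, (Pi.single i 1 : κ → ℂ) ⊗ₜ[ℂ] a i) ≤ ENNReal.ofReal c := by
  refine iSup_le fun p => iSup_le fun q => iSup_le fun T => iSup_le fun S => iSup_le fun hT =>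
    iSup_le fun hS => ?_
  rw [cbNorm_le_one_iff] at hT hS
  have hTS := hT q _ (h q S hS)
  have h1 : tensorMap T S (∑ i, (Pi.single i 1 : κ → ℂ) ⊗ₜ[ℂ] a i) = (c : ℂ) •
      (Matrix.comp _ _ _ _ ℂ ((Matrix.of fun r s i => (c : ℂ)⁻¹ * S (a i) r s).map T)).submatrix
        (Equiv.prodComm _ _) (Equiv.prodComm _ _) := by
    ext ⟨i, r⟩ ⟨j, s⟩
    have hc' : (c : ℂ) ≠ 0 := by exact_mod_cast hc.ne'
    have hsingle (k : κ) : (fun l => if k = l then (1 : ℂ) else 0) = Pi.single k 1 := by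
      ext l; simp only [Pi.single_apply, eq_comm]
    simp only [tensorMap_eq_rectTensorMap, map_sum, rectTensorMap_tmul, Matrix.sum_apply,
      kroneckerMap_apply, Matrix.smul_apply, submatrix_apply, Equiv.prodComm_apply,
      Prod.swap_prod_mk, Matrix.comp_apply, Matrix.map_apply, Matrix.of_apply,
      LinearMap.pi_apply_eq_sum_univ T (fun i => (c : ℂ)⁻¹ * S (a i) r s), hsingle, Finset.mul_sum,
      smul_eq_mul]
    refine Finset.sum_congr rfl fun k _ => ?_
    field_simp
  rw [opNorm_eq_enorm, ← ofReal_norm, h1, norm_smul, l2_opNorm_submatrix_equiv]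
  refine ENNReal.ofReal_le_ofReal ?_
  rw [Complex.norm_real, Real.norm_of_nonneg hc.le]
  exact mul_le_of_le_one_right hc.le hTS

theorem minNorm_rowNorms_le (hc : 0 < c) {a : κ → W}
    (h : ∀ (q : ℕ) (S : W →ₗ[ℂ] Matrix (Fin q) (Fin q) ℂ), IsCompleteContraction NW S →
      ‖rowStack fun i => S (a i)‖ ≤ c) :
    minNorm (rowNorms κ) NW (∑ i, (Pi.single i 1 : κ → ℂ) ⊗ₜ[ℂ] a i) ≤ ENNReal.ofReal c := by
  refine minNorm_sum_single_tmul_le hc fun q S hS => rowNorms_le_one_iff.mpr ?_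
  calc ‖(c : ℂ)⁻¹ • rowStack fun i => S (a i)‖ = c⁻¹ * ‖rowStack fun i => S (a i)‖ := by
        rw [norm_smul, norm_inv, Complex.norm_real, Real.norm_of_nonneg hc.le]
    _ ≤ 1 := inv_mul_le_one_of_le₀ (h q S hS) hc.le

theorem minNorm_colNorms_le (hc : 0 < c) {a : κ → W}
    (h : ∀ (q : ℕ) (S : W →ₗ[ℂ] Matrix (Fin q) (Fin q) ℂ), IsCompleteContraction NW S →
      ‖colStack fun i => S (a i)‖ ≤ c) :
    minNorm (colNorms κ) NW (∑ i, (Pi.single i 1 : κ → ℂ) ⊗ₜ[ℂ] a i) ≤ ENNReal.ofReal c := by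
  refine minNorm_sum_single_tmul_le hc fun q S hS => colNorms_le_one_iff.mpr ?_
  calc ‖(c : ℂ)⁻¹ • colStack fun i => S (a i)‖ = c⁻¹ * ‖colStack fun i => S (a i)‖ := by
        rw [norm_smul, norm_inv, Complex.norm_real, Real.norm_of_nonneg hc.le]
    _ ≤ 1 := inv_mul_le_one_of_le₀ (h q S hS) hc.le

theorem haagerupNorm_le {V : Type*} [AddCommGroup V] [Module ℂ V] {NV : MatrixNorms V}
    {u : V ⊗[ℂ] W} {a : κ → V} {b : κ → W} {d : ℝ}
    (hu : u = ∑ i, a i ⊗ₜ[ℂ] b i) (hc : 0 < c) (hd : 0 < d)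
    (ha : ∀ (q : ℕ) (T : V →ₗ[ℂ] Matrix (Fin q) (Fin q) ℂ), IsCompleteContraction NV T →
      ‖rowStack fun i => T (a i)‖ ≤ c)
    (hb : ∀ (q : ℕ) (S : W →ₗ[ℂ] Matrix (Fin q) (Fin q) ℂ), IsCompleteContraction NW S →
      ‖colStack fun i => S (b i)‖ ≤ d) :
    haagerupNorm NV NW u ≤ ENNReal.ofReal (c * d) := by
  let e := (Fintype.equivFin κ).symm
  refine iInf_le_of_le _ <| iInf_le_of_le (a ∘ e) <| iInf_le_of_le (b ∘ e) <| iInf_le_of_le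
    (hu.trans (e.sum_comp fun i => a i ⊗ₜ[ℂ] b i).symm) ?_
  rw [ENNReal.ofReal_mul hc.le]
  gcongr
  · exact minNorm_rowNorms_le hc fun q T hT =>
      (l2_opNorm_rowStack_comp_equiv (fun i => T (a i)) e).trans_le (ha q T hT)
  · exact minNorm_colNorms_le hd fun q S hS =>
      (l2_opNorm_colStack_comp_equiv (fun i => S (b i)) e).trans_le (hb q S hS)

end UpperBound

end RowColumn

/-! ### Kraus operators -/

section Kraus

variable {m I : Type*} [Fintype m] [Fintype I]

/-- The completely positive map `X ↦ ∑ K_i X K_iᴴ`. -/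
def krausMap (K : I → Matrix m m ℂ) : Matrix m m ℂ →ₗ[ℂ] Matrix m m ℂ where
  toFun X := ∑ i, K i * X * (K i)ᴴ
  map_add' X Y := by simp [mul_add, add_mul, Finset.sum_add_distrib]
  map_smul' c X := by simp [Finset.smul_sum]

theorem krausMap_apply_apply (K : I → Matrix m m ℂ) (X : Matrix m m ℂ) (x y : m) :
    krausMap K X x y = ∑ i, ∑ k, ∑ l, K i x k * X k l * star (K i y l) := by
  simp only [krausMap, LinearMap.coe_mk, AddHom.coe_mk, Matrix.sum_apply, Matrix.mul_apply,
    conjTranspose_apply, Finset.sum_mul]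
  exact Finset.sum_congr rfl fun i _ => Finset.sum_comm

theorem ampliate_krausMap {r : Type*} [Fintype r] [DecidableEq r] (K : I → Matrix m m ℂ)
    (X : Matrix (m × r) (m × r) ℂ) :
    ampliate (krausMap K) X =
      ∑ i, (K i ⊗ₖ (1 : Matrix r r ℂ)) * X * (K i ⊗ₖ (1 : Matrix r r ℂ))ᴴ := by
  ext ⟨x, r⟩ ⟨y, s⟩
  simp only [ampliate, Matrix.of_apply, krausMap_apply_apply, Matrix.sum_apply, Matrix.mul_apply,
    conjTranspose_apply, kroneckerMap_apply, Fintype.sum_prod_type, Matrix.one_apply]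
  refine Finset.sum_congr rfl fun i _ => ?_
  rw [Finset.sum_comm]
  simp [Finset.sum_mul, apply_ite (starRingEnd ℂ)]

section Composite

variable {r N : Type*} (e : N ≃ m × r)

/-- The operator `K` acting on the part `m` of a composite system `N ≃ m × r`. -/
def liftVec (K : Matrix m m ℂ) (v : EuclideanSpace ℂ N) : EuclideanSpace ℂ N :=
  toLp 2 fun n => ∑ k, K (e n).1 k * v (e.symm (k, (e n).2))

theorem applyOn_krausMap_pureState (K : I → Matrix m m ℂ) (v : EuclideanSpace ℂ N) :
    applyOn e (krausMap K) (pureState v) = ∑ i, pureState (liftVec e (K i) v) := by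
  ext x y
  simp only [applyOn, ampliate, submatrix_apply, Matrix.of_apply, krausMap_apply_apply, pureState,
    Matrix.sum_apply, liftVec, star_sum, star_mul', Finset.sum_mul_sum]
  refine Finset.sum_congr rfl fun i _ => Finset.sum_congr rfl fun k _ =>
    Finset.sum_congr rfl fun l _ => ?_
  ring

end Composite

theorem applyOn_sum {m r N : Type*} (e : N ≃ m × r) (T : Matrix m m ℂ →ₗ[ℂ] Matrix m m ℂ)
    (X : I → Matrix N N ℂ) : applyOn e T (∑ i, X i) = ∑ i, applyOn e T (X i) := by
  ext x y
  have hblock : (Matrix.of fun k l => ∑ i, X i (e.symm (k, (e x).2)) (e.symm (l, (e y).2))) =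
      ∑ i, Matrix.of fun k l => X i (e.symm (k, (e x).2)) (e.symm (l, (e y).2)) := by
    ext
    simp only [Matrix.sum_apply, Matrix.of_apply]
  simp only [applyOn, ampliate, submatrix_apply, Matrix.of_apply, Matrix.sum_apply, hblock, map_sum]

variable [DecidableEq m]

theorem isQuantumOperation_krausMap {K : I → Matrix m m ℂ} (hK : ∑ i, (K i)ᴴ * K i = 1) :
    IsQuantumOperation (krausMap K) where
  completelyPositive n X hX := by
    rw [ampliate_krausMap]
    exact posSemidef_sum _ fun i _ => hX.mul_mul_conjTranspose_same _
  tracePreserving X :=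
    calc (krausMap K X).trace = ∑ i, (K i * X * (K i)ᴴ).trace := trace_sum ..
      _ = ∑ i, ((K i)ᴴ * K i * X).trace :=
        Finset.sum_congr rfl fun i _ => Matrix.trace_mul_cycle _ _ _
      _ = X.trace := by rw [← trace_sum, ← Finset.sum_mul, hK, one_mul]

open scoped MatrixOrder in
theorem exists_isQuantumOperation_krausMap {K : Matrix m m ℂ} (h : ‖K‖ ≤ 1) :
    ∃ L : Fin 2 → Matrix m m ℂ, L 0 = K ∧ IsQuantumOperation (krausMap L) := by
  have hgram : star K * K ≤ 1 := by
    rw [← CStarAlgebra.norm_le_one_iff_of_nonneg _ (star_mul_self_nonneg K),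
      CStarRing.norm_star_mul_self]
    exact mul_le_one₀ h (norm_nonneg K) h
  obtain ⟨L, hL⟩ := CStarAlgebra.nonneg_iff_eq_star_mul_self.mp (sub_nonneg.mpr hgram)
  refine ⟨![K, L], rfl, isQuantumOperation_krausMap ?_⟩
  rw [Fin.sum_univ_two]
  exact add_eq_of_eq_sub' hL.symm

/-- The Kraus operators are read off from a decomposition of the Choi matrix into rank-one
operators. -/
theorem IsQuantumOperation.exists_apply_single {T : Matrix m m ℂ →ₗ[ℂ] Matrix m m ℂ}
    (hT : IsQuantumOperation T) :
    ∃ (n : ℕ) (K : Fin n → Matrix m m ℂ),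
      ∀ a b i j, T (Matrix.single a b 1) i j = ∑ r, K r i a * star (K r j b) := by
  let e := Fintype.equivFin m
  let w : m × Fin (Fintype.card m) → ℂ := fun x => if e x.1 = x.2 then 1 else 0
  obtain ⟨n, v, hv⟩ := posSemidef_iff_eq_sum_vecMulVec.mp
    (hT.completelyPositive _ _ (posSemidef_vecMulVec_self_star w))
  refine ⟨n, fun r => Matrix.of fun i a => v r (i, e a), fun a b i j => ?_⟩
  have hsingle : (Matrix.of fun i j => vecMulVec w (star w) (i, e a) (j, e b)) =
      Matrix.single a b (1 : ℂ) := by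
    ext i j
    simp only [Matrix.of_apply, vecMulVec_apply, Pi.star_apply, w, Matrix.single_apply,
      EmbeddingLike.apply_eq_iff_eq]
    by_cases hi : i = a <;> by_cases hj : j = b <;> simp [hi, hj, Ne.symm]
  rw [← hsingle]
  simpa [ampliate, Matrix.sum_apply, vecMulVec_apply] using
    congrFun (congrFun hv (i, e a)) (j, e b)

theorem IsQuantumOperation.exists_krausMap {T : Matrix m m ℂ →ₗ[ℂ] Matrix m m ℂ}
    (hT : IsQuantumOperation T) :
    ∃ (n : ℕ) (K : Fin n → Matrix m m ℂ), T = krausMap K ∧ ‖colStack K‖ ≤ 1 := by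
  obtain ⟨n, K, hK⟩ := hT.exists_apply_single
  have hTK : T = krausMap K := by
    refine Matrix.ext_linearMap ℂ fun a b => LinearMap.ext_ring ?_
    ext i j
    simp [hK, krausMap_apply_apply, Matrix.single_apply, ite_and]
  have hsum : ∑ i, (K i)ᴴ * K i = 1 := by
    ext b a
    have htrace := hT.tracePreserving (Matrix.single a b 1)
    simp only [Matrix.trace, Matrix.diag, hK] at htrace
    rw [Finset.sum_comm] at htrace
    simp only [Matrix.sum_apply, Matrix.mul_apply, conjTranspose_apply, mul_comm (star _), htrace]
    simp [Matrix.single_apply, Matrix.one_apply, ite_and]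
  exact ⟨n, K, hTK, l2_opNorm_le_one_of_conjTranspose_mul_self
    (by rw [conjTranspose_colStack_mul_self, hsum])⟩

end Kraus

section WinningProbability

namespace Game

variable {α β χ : Type*} [Fintype α] [Fintype β] [Fintype χ] (G : Game α β χ)
variable {E I : Type*} [Fintype E] [DecidableEq E] [Fintype I]

/-- The vector `(⟨γ| ⊗ 1) v` of the auxiliary system. -/
def overlap {E : Type*} (v : EuclideanSpace ℂ ((α × β × χ) × E)) : EuclideanSpace ℂ E :=
  toLp 2 fun z => ∑ x, star (G.γ x) * v (x, z)

theorem winProb_pureState (v : EuclideanSpace ℂ ((α × β × χ) × E)) :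
    G.winProb (pureState v) = ‖G.overlap v‖ ^ 2 := by
  have htrace : ((pureState G.γ ⊗ₖ (1 : Matrix E E ℂ)) * pureState v).trace =
      inner ℂ (G.overlap v) (G.overlap v) := by
    simp only [Matrix.trace, Matrix.diag, Matrix.mul_apply, kroneckerMap_apply, pureState,
      Matrix.of_apply, Matrix.one_apply, PiLp.inner_apply, RCLike.inner_apply', overlap, map_sum,
      map_mul, Complex.star_def, Complex.conj_conj, Finset.sum_mul_sum]
    rw [Fintype.sum_prod_type_right]
    refine Finset.sum_congr rfl fun z _ => Finset.sum_congr rfl fun x _ => ?_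
    rw [Fintype.sum_prod_type]
    refine Finset.sum_congr rfl fun y _ => ?_
    simp only [mul_ite, ite_mul, mul_one, mul_zero, zero_mul, Finset.sum_ite_eq, Finset.mem_univ,
      if_true]
    ring
  rw [winProb, htrace]
  exact inner_self_eq_norm_sq (𝕜 := ℂ) _

theorem winProb_sum (ρ : I → Matrix ((α × β × χ) × E) ((α × β × χ) × E) ℂ) :
    G.winProb (∑ i, ρ i) = ∑ i, G.winProb (ρ i) := by
  simp only [winProb, Finset.mul_sum, trace_sum, Complex.re_sum]

theorem winProb_krausMap {m r : Type*} [Fintype m] (e : (α × β × χ) × E ≃ m × r)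
    (K : I → Matrix m m ℂ) (v : EuclideanSpace ℂ ((α × β × χ) × E)) :
    G.winProb (applyOn e (krausMap K) (pureState v)) =
      ∑ i, ‖G.overlap (liftVec e (K i) v)‖ ^ 2 := by
  simp only [applyOn_krausMap_pureState, winProb_sum, winProb_pureState]

theorem winProb_krausMap_krausMap {m r m' r' J : Type*} [Fintype m] [Fintype m'] [Fintype J]
    (e : (α × β × χ) × E ≃ m × r) (e' : (α × β × χ) × E ≃ m' × r')
    (K : I → Matrix m m ℂ) (L : J → Matrix m' m' ℂ) (v : EuclideanSpace ℂ ((α × β × χ) × E)) :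
    G.winProb (applyOn e' (krausMap L) (applyOn e (krausMap K) (pureState v))) =
      ∑ i, ∑ j, ‖G.overlap (liftVec e' (L j) (liftVec e (K i) v))‖ ^ 2 := by
  simp only [applyOn_krausMap_pureState, applyOn_sum, winProb_sum, winProb_pureState]

theorem norm_overlap_sq_le_winProb_krausMap {m r : Type*} [Fintype m]
    (e : (α × β × χ) × E ≃ m × r) (K : I → Matrix m m ℂ)
    (v : EuclideanSpace ℂ ((α × β × χ) × E)) (i : I) :
    ‖G.overlap (liftVec e (K i) v)‖ ^ 2 ≤ G.winProb (applyOn e (krausMap K) (pureState v)) := by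
  rw [winProb_krausMap]
  exact Finset.single_le_sum (f := fun i => ‖G.overlap (liftVec e (K i) v)‖ ^ 2)
    (fun i _ => sq_nonneg _) (Finset.mem_univ i)

theorem norm_overlap_sq_le_winProb_krausMap_krausMap {m r m' r' J : Type*} [Fintype m]
    [Fintype m'] [Fintype J] (e : (α × β × χ) × E ≃ m × r) (e' : (α × β × χ) × E ≃ m' × r')
    (K : I → Matrix m m ℂ) (L : J → Matrix m' m' ℂ) (v : EuclideanSpace ℂ ((α × β × χ) × E))
    (i : I) (j : J) :
    ‖G.overlap (liftVec e' (L j) (liftVec e (K i) v))‖ ^ 2 ≤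
      G.winProb (applyOn e' (krausMap L) (applyOn e (krausMap K) (pureState v))) := by
  let f (i : I) (j : J) : ℝ := ‖G.overlap (liftVec e' (L j) (liftVec e (K i) v))‖ ^ 2
  have hf (i : I) (j : J) : 0 ≤ f i j := sq_nonneg _
  calc f i j ≤ ∑ j, f i j := Finset.single_le_sum (fun j _ => hf i j) (Finset.mem_univ j)
    _ ≤ ∑ i, ∑ j, f i j :=
        Finset.single_le_sum (f := fun i => ∑ j, f i j)
          (fun i _ => Finset.sum_nonneg fun j _ => hf i j) (Finset.mem_univ i)
    _ = _ := (G.winProb_krausMap_krausMap e e' K L v).symm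

end Game

end WinningProbability

/-! ### The entangled value -/

section EntangledValue

theorem sq_le_iff_le_rpow_inv_two {a b : ℝ≥0∞} : a ^ 2 ≤ b ↔ a ≤ b ^ (2⁻¹ : ℝ) := by
  rw [ENNReal.le_rpow_inv_iff two_pos, ENNReal.rpow_two]

theorem enorm_sq_le_of_forall_norm_eq_one {m n : Type*} [Fintype m] [Fintype n] [DecidableEq n]
    {X : Matrix m n ℂ} {c : ℝ≥0∞}
    (h : ∀ v : EuclideanSpace ℂ n, ‖v‖ = 1 → ‖toLp 2 (X *ᵥ v)‖ₑ ^ 2 ≤ c) : ‖X‖ₑ ^ 2 ≤ c := by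
  simp only [sq_le_iff_le_rpow_inv_two] at h ⊢
  generalize c ^ (2⁻¹ : ℝ) = d at h ⊢
  induction d with
  | top => exact le_top
  | coe d =>
    refine enorm_le_coe.mpr (ContinuousLinearMap.opNNNorm_le_of_unit_nnnorm fun v hv => ?_)
    exact enorm_le_coe.mp (h v (by rw [← coe_nnnorm, hv, NNReal.coe_one]))

namespace Game

variable {α β χ : Type*} [Fintype α] [Fintype β] [Fintype χ] [DecidableEq α] [DecidableEq β]
  (G : Game α β χ)

theorem overlap_entangled {P Q : Type*} [Fintype P] [Fintype Q] (K : Matrix (α × P) (α × P) ℂ)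
    (L : Matrix (β × Q) (β × Q) ℂ) (φ : EuclideanSpace ℂ (P × Q)) :
    G.overlap (liftVec (bobSplit α β χ P Q) L
      (liftVec (aliceSplit α β χ P Q) K (tensorVec G.ψ φ))) =
    toLp 2 ((rectTensorMap (ofBlockMatrix Kᵀ) (ofBlockMatrix Lᵀ) (toTensor G.M))ᵀ *ᵥ φ) := by
  ext z
  simp only [mulVec, dotProduct, transpose_apply, rectTensorMap_toTensor,
    blockMatrix_ofBlockMatrix, overlap, liftVec, bobSplit, aliceSplit, tensorVec, M,
    Matrix.of_apply, Equiv.coe_fn_mk, Equiv.coe_fn_symm_mk, Finset.mul_sum, Finset.sum_mul]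
  simp only [← Fintype.sum_prod_type']
  let e : (α × β × χ) × ((β × Q) × (α × P)) ≃ (P × Q) × (α × α × β × β × χ) :=
    { toFun := fun t => ((t.2.2.2, t.2.1.2), t.2.2.1, t.1.1, t.2.1.1, t.1.2.1, t.1.2.2)
      invFun := fun t => ((t.2.2.1, t.2.2.2.2.1, t.2.2.2.2.2), (t.2.2.2.1, t.1.2), (t.2.1, t.1.1)) }
  refine Fintype.sum_equiv e _ _ fun t => ?_
  dsimp only [e, Equiv.coe_fn_mk]
  ring

/-- The transposed column of Kraus operators on `AA'`, as the block matrix of a map on `S_1^A`. -/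
def krausBlock {α I P : Type*} (K : I → Matrix (α × P) (α × P) ℂ) :
    Matrix (α × P) (α × (P × I)) ℂ :=
  (colStack K)ᵀ.submatrix id (Equiv.prodAssoc α P I).symm

theorem isCompleteContraction_ofBlockMatrix_krausBlock {I P : Type*} [Fintype I] [Fintype P]
    [DecidableEq I] [DecidableEq P] {K : I → Matrix (α × P) (α × P) ℂ} (h : ‖colStack K‖ ≤ 1) :
    IsCompleteContraction (s1Norms α) (ofBlockMatrix (krausBlock K)) := by
  refine isCompleteContraction_s1Norms_of_blockMatrix ?_
  rwa [blockMatrix_ofBlockMatrix, krausBlock, ← Equiv.coe_refl, l2_opNorm_submatrix_equiv,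
    l2_opNorm_transpose]

theorem sum_norm_overlap_entangled_sq {P Q I J : Type*} [Fintype P] [Fintype Q] [Fintype I]
    [Fintype J] (K : I → Matrix (α × P) (α × P) ℂ) (L : J → Matrix (β × Q) (β × Q) ℂ)
    (φ : EuclideanSpace ℂ (P × Q)) :
    ∑ i, ∑ j, ‖G.overlap (liftVec (bobSplit α β χ P Q) (L j)
      (liftVec (aliceSplit α β χ P Q) (K i) (tensorVec G.ψ φ)))‖ ^ 2 =
    ‖toLp 2 ((rectTensorMap (ofBlockMatrix (krausBlock K)) (ofBlockMatrix (krausBlock L))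
      (toTensor G.M))ᵀ *ᵥ φ)‖ ^ 2 := by
  simp only [overlap_entangled, EuclideanSpace.norm_sq_eq, ← Fintype.sum_prod_type']
  let e : I × J × P × Q ≃ (P × I) × (Q × J) :=
    { toFun := fun t => ((t.2.2.1, t.1), (t.2.2.2, t.2.1))
      invFun := fun t => (t.1.2, t.2.2, t.1.1, t.2.1) }
  refine Fintype.sum_equiv e _ _ fun t => ?_
  simp only [mulVec, dotProduct, transpose_apply, rectTensorMap_toTensor,
    blockMatrix_ofBlockMatrix]
  rfl

theorem entangledValue_le :
    G.entangledValue ≤ minNorm (s1Norms α) (s1Norms β) (toTensor G.M) ^ 2 := by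
  refine iSup_le fun p => iSup_le fun q => iSup_le fun φ => iSup_le fun T => iSup_le fun S =>
    iSup_le fun hφ => iSup_le fun hT => iSup_le fun hS => ?_
  obtain ⟨m, K, rfl, hK⟩ := hT.exists_krausMap
  obtain ⟨n, L, rfl, hL⟩ := hS.exists_krausMap
  rw [winProb_krausMap_krausMap, sum_norm_overlap_entangled_sq, ENNReal.ofReal_pow (norm_nonneg _)]
  gcongr
  set Y := rectTensorMap (ofBlockMatrix (krausBlock K)) (ofBlockMatrix (krausBlock L))
    (toTensor G.M)
  calc ENNReal.ofReal ‖toLp 2 (Yᵀ *ᵥ φ)‖ ≤ ENNReal.ofReal ‖Y‖ := by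
        gcongr
        simpa [hφ, l2_opNorm_transpose] using norm_toLp_mulVec_le Yᵀ φ
    _ ≤ minNorm (s1Norms α) (s1Norms β) (toTensor G.M) := by
        rw [ofReal_norm]
        exact enorm_rectTensorMap_le_minNorm (isCompleteContraction_ofBlockMatrix_krausBlock hK)
          (isCompleteContraction_ofBlockMatrix_krausBlock hL) _

theorem enorm_overlap_sq_le_entangledValue {p q : ℕ} {K : Matrix (α × Fin p) (α × Fin p) ℂ}
    {L : Matrix (β × Fin q) (β × Fin q) ℂ} (hK : ‖K‖ ≤ 1) (hL : ‖L‖ ≤ 1)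
    {φ : EuclideanSpace ℂ (Fin p × Fin q)} (hφ : ‖φ‖ = 1) :
    ‖G.overlap (liftVec (bobSplit α β χ (Fin p) (Fin q)) L
      (liftVec (aliceSplit α β χ (Fin p) (Fin q)) K (tensorVec G.ψ φ)))‖ₑ ^ 2 ≤
        G.entangledValue := by
  obtain ⟨K', rfl, hK'⟩ := exists_isQuantumOperation_krausMap hK
  obtain ⟨L', rfl, hL'⟩ := exists_isQuantumOperation_krausMap hL
  refine le_iSup_of_le p <| le_iSup_of_le q <| le_iSup_of_le φ <| le_iSup_of_le (krausMap K') <|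
    le_iSup_of_le (krausMap L') <| le_iSup_of_le hφ <| le_iSup_of_le hK' <| le_iSup_of_le hL' ?_
  rw [← ofReal_norm, ← ENNReal.ofReal_pow (norm_nonneg _)]
  exact ENNReal.ofReal_le_ofReal (G.norm_overlap_sq_le_winProb_krausMap_krausMap ..)

theorem le_entangledValue :
    minNorm (s1Norms α) (s1Norms β) (toTensor G.M) ^ 2 ≤ G.entangledValue := by
  rw [sq_le_iff_le_rpow_inv_two]
  refine iSup_le fun p => iSup_le fun q => iSup_le fun T => iSup_le fun S => iSup_le fun hT =>
    iSup_le fun hS => ?_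
  rw [cbNorm_le_one_iff] at hT hS
  rw [← sq_le_iff_le_rpow_inv_two, opNorm_eq_enorm,
    enorm_eq_iff_norm_eq.mpr (l2_opNorm_transpose _).symm]
  refine enorm_sq_le_of_forall_norm_eq_one fun φ hφ => ?_
  have hK : ‖(blockMatrix T)ᵀ‖ ≤ 1 := (l2_opNorm_transpose _).trans_le hT.norm_blockMatrix_le
  have hL : ‖(blockMatrix S)ᵀ‖ ≤ 1 := (l2_opNorm_transpose _).trans_le hS.norm_blockMatrix_le
  simpa only [overlap_entangled, transpose_transpose, ofBlockMatrix_blockMatrix,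
    tensorMap_eq_rectTensorMap] using G.enorm_overlap_sq_le_entangledValue hK hL hφ

end Game

end EntangledValue

/-! ### The trace norm and the maximal value -/

section TraceNorm

section SingularValueDecomposition

variable {𝕜 E : Type*} [RCLike 𝕜] [NormedAddCommGroup E] [InnerProductSpace 𝕜 E]
  [FiniteDimensional 𝕜 E] {n : ℕ}

theorem inner_apply_eigenvectorBasis_adjoint_comp_self (f : E →ₗ[𝕜] E)
    (hn : Module.finrank 𝕜 E = n) (i j : Fin n) :
    inner 𝕜 (f (f.isSymmetric_adjoint_comp_self.eigenvectorBasis hn i))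
      (f (f.isSymmetric_adjoint_comp_self.eigenvectorBasis hn j)) =
      if i = j then ((f.singularValues j ^ 2 : ℝ) : 𝕜) else 0 := by
  rw [← LinearMap.adjoint_inner_right, ← LinearMap.comp_apply,
    f.isSymmetric_adjoint_comp_self.apply_eigenvectorBasis hn, inner_smul_right,
    ← f.sq_singularValues_fin hn, orthonormal_iff_ite.mp (OrthonormalBasis.orthonormal _)]
  simp only [mul_ite, mul_one, mul_zero]

theorem exists_orthonormalBasis_apply_eq_singularValues_smul (f : E →ₗ[𝕜] E)
    (hn : Module.finrank 𝕜 E = n) :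
    ∃ b c : OrthonormalBasis (Fin n) 𝕜 E, ∀ i, f (b i) = (f.singularValues i : 𝕜) • c i := by
  let b := f.isSymmetric_adjoint_comp_self.eigenvectorBasis hn
  have hinner (i j : Fin n) : inner 𝕜 (f (b i)) (f (b j)) =
      if i = j then ((f.singularValues j ^ 2 : ℝ) : 𝕜) else 0 :=
    inner_apply_eigenvectorBasis_adjoint_comp_self f hn i j
  have horth : Pairwise fun i j => inner 𝕜 (f (b i)) (f (b j)) = 0 := fun i j hij =>
    (hinner i j).trans (if_neg hij)
  have hnorm (i : Fin n) : ‖f (b i)‖ = f.singularValues i := by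
    rw [← sq_eq_sq₀ (norm_nonneg _) (f.singularValues_nonneg i), ← inner_self_eq_norm_sq (𝕜 := 𝕜),
      hinner, if_pos rfl, RCLike.ofReal_re]
  have hcard : Module.finrank 𝕜 E = Fintype.card (Fin n) := by rw [hn, Fintype.card_fin]
  refine ⟨b, InnerProductSpace.gramSchmidtOrthonormalBasis hcard fun i => f (b i), fun i => ?_⟩
  rcases eq_or_ne (f (b i)) 0 with hi | hi
  · rw [← hnorm, hi, norm_zero, RCLike.ofReal_zero, zero_smul]
  · rw [InnerProductSpace.gramSchmidtOrthonormalBasis_apply_of_orthogonal hcard horth hi, ← hnorm,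
      smul_inv_smul₀ (by simpa using hi)]

theorem sum_singularValues (f : E →ₗ[𝕜] E) (hn : Module.finrank 𝕜 E = n) :
    (f.singularValues.sum fun _ s => s) = ∑ i : Fin n, f.singularValues i := by
  rw [Finsupp.sum_of_support_subset _ (s := Finset.range n) _ _ (fun _ _ => rfl),
    Finset.sum_range]
  intro i hi
  by_contra hni
  exact Finsupp.mem_support_iff.mp hi
    (f.singularValues_of_finrank_le (by simpa [hn] using hni))

end SingularValueDecomposition

variable {ι : Type*} [Fintype ι] [DecidableEq ι]

theorem trace_mul_eq_sum_mul_inner {n : ℕ} {X : Matrix ι ι ℂ} (W : Matrix ι ι ℂ) {σ : Fin n → ℂ}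
    {b c : OrthonormalBasis (Fin n) ℂ (EuclideanSpace ℂ ι)}
    (h : ∀ i, toEuclideanLin X (b i) = σ i • c i) :
    (X * W).trace = ∑ i, σ i * inner ℂ (b i) (toEuclideanLin W (c i)) := by
  have htrace : (toEuclideanLin W ∘ₗ toEuclideanLin X).trace ℂ _ = (X * W).trace := by
    rw [toEuclideanLin_eq_toLin_orthonormal, ← Matrix.toLin_mul, Matrix.trace_toLin_eq,
      Matrix.trace_mul_comm]
  rw [← htrace, LinearMap.trace_eq_sum_inner _ b]
  simp only [LinearMap.comp_apply, h, map_smul, inner_smul_right]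

theorem exists_singularValueDecomposition (X : Matrix ι ι ℂ) :
    ∃ (n : ℕ) (σ : Fin n → ℝ) (b c : OrthonormalBasis (Fin n) ℂ (EuclideanSpace ℂ ι)),
      (∀ i, 0 ≤ σ i) ∧ traceNorm X = ENNReal.ofReal (∑ i, σ i) ∧
        ∀ i, toEuclideanLin X (b i) = (σ i : ℂ) • c i := by
  obtain ⟨b, c, hbc⟩ := exists_orthonormalBasis_apply_eq_singularValues_smul (toEuclideanLin X) rfl
  exact ⟨_, _, b, c, fun i => LinearMap.singularValues_nonneg _ i,
    by rw [traceNorm, sum_singularValues _ rfl], hbc⟩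

theorem enorm_trace_mul_le (X W : Matrix ι ι ℂ) : ‖(X * W).trace‖ₑ ≤ traceNorm X * ‖W‖ₑ := by
  obtain ⟨n, σ, b, c, hσ, hX, hbc⟩ := exists_singularValueDecomposition X
  rw [hX, ← ofReal_norm, ← ofReal_norm, ← ENNReal.ofReal_mul (Finset.sum_nonneg fun i _ => hσ i),
    trace_mul_eq_sum_mul_inner W hbc, Finset.sum_mul]
  refine ENNReal.ofReal_le_ofReal (norm_sum_le_of_le _ fun i _ => ?_)
  rw [norm_mul, Complex.norm_real, Real.norm_of_nonneg (hσ i)]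
  refine mul_le_mul_of_nonneg_left ?_ (hσ i)
  calc ‖inner ℂ (b i) (toEuclideanLin W (c i))‖ ≤ ‖b i‖ * ‖toEuclideanLin W (c i)‖ :=
        norm_inner_le_norm _ _
    _ ≤ 1 * (‖W‖ * ‖c i‖) := by
        rw [b.norm_eq_one]
        exact mul_le_mul_of_nonneg_left (l2_opNorm_mulVec W (c i)) zero_le_one
    _ = ‖W‖ := by rw [c.norm_eq_one, one_mul, mul_one]

theorem exists_enorm_trace_mul_eq_traceNorm (X : Matrix ι ι ℂ) :
    ∃ W : Matrix ι ι ℂ, ‖W‖ ≤ 1 ∧ ‖(X * W).trace‖ₑ = traceNorm X := by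
  obtain ⟨n, σ, b, c, hσ, hX, hbc⟩ := exists_singularValueDecomposition X
  let U := c.equiv b (.refl _)
  let W := toEuclideanLin.symm U.toLinearEquiv.toLinearMap
  have hW : ∀ v, toEuclideanLin W v = U v := fun v => by
    rw [LinearEquiv.apply_symm_apply]
    rfl
  refine ⟨W, l2_opNorm_le_of_forall_mulVec zero_le_one fun v => ?_, ?_⟩
  · rw [one_mul]
    exact ((congrArg norm (hW v)).trans (U.norm_map v)).le
  · rw [hX, trace_mul_eq_sum_mul_inner W hbc, ← ofReal_norm]
    simp only [hW, U, OrthonormalBasis.equiv_apply_basis, Equiv.refl_apply,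
      inner_self_eq_norm_sq_to_K, b.norm_eq_one, RCLike.ofReal_one, one_pow, mul_one]
    rw [← Complex.ofReal_sum, Complex.norm_real,
      Real.norm_of_nonneg (Finset.sum_nonneg fun i _ => hσ i)]

end TraceNorm

section MaximalValue

namespace Game

variable {α β χ : Type*} [Fintype α] [Fintype β] [Fintype χ] (G : Game α β χ) {d : ℕ}

/-- The block `(1 ⊗ ⟨z|) K (1 ⊗ |φ⟩)` of an operator `K` on `ABE`, an operator on `AB`. -/
def restrictState (φ : EuclideanSpace ℂ (Fin d)) (K : Matrix (α × β × Fin d) (α × β × Fin d) ℂ)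
    (z : Fin d) : Matrix (α × β) (α × β) ℂ :=
  Matrix.of fun x y => ∑ k, K (x.1, x.2, z) (y.1, y.2, k) * φ k

theorem overlap_joint (K : Matrix (α × β × Fin d) (α × β × Fin d) ℂ)
    (φ : EuclideanSpace ℂ (Fin d)) (z : Fin d) :
    G.overlap (liftVec (jointSplit α β χ (Fin d)) K (tensorVec G.ψ φ)) z =
      (G.M * restrictState φ K z).trace := by
  simp only [overlap, liftVec, jointSplit, tensorVec, M, Matrix.of_apply, restrictState,
    Equiv.coe_fn_mk, Equiv.coe_fn_symm_mk, Matrix.trace, Matrix.diag, Matrix.mul_apply,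
    Finset.sum_mul, Finset.mul_sum]
  simp only [← Fintype.sum_prod_type']
  let e : (α × β × χ) × (α × β × Fin d) ≃ (α × β) × (α × β) × Fin d × χ :=
    { toFun := fun t => ((t.2.1, t.2.2.1), (t.1.1, t.1.2.1), t.2.2.2, t.1.2.2)
      invFun := fun t => ((t.2.1.1, t.2.1.2, t.2.2.2), (t.1.1, t.1.2, t.2.2.1)) }
  refine Fintype.sum_equiv e _ _ fun t => ?_
  dsimp only [e, Equiv.coe_fn_mk]
  ring

variable [DecidableEq α] [DecidableEq β]

theorem l2_opNorm_colStack_restrictState_le {I : Type*} [Fintype I]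
    (K : I → Matrix (α × β × Fin d) (α × β × Fin d) ℂ) {φ : EuclideanSpace ℂ (Fin d)}
    (hφ : ‖φ‖ = 1) :
    ‖colStack fun y : I × Fin d => restrictState φ (K y.1) y.2‖ ≤ ‖colStack K‖ := by
  refine l2_opNorm_le_of_forall_mulVec (norm_nonneg _) fun u => ?_
  let v : EuclideanSpace ℂ (α × β × Fin d) := toLp 2 fun x => u (x.1, x.2.1) * φ x.2.2
  have hv : ‖v‖ = ‖u‖ := by
    have h : ∑ k, ‖φ k‖ ^ 2 = 1 := by rw [← EuclideanSpace.norm_sq_eq, hφ, one_pow]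
    rw [← sq_eq_sq₀ (norm_nonneg _) (norm_nonneg _), EuclideanSpace.norm_sq_eq,
      EuclideanSpace.norm_sq_eq]
    simp only [v, Fintype.sum_prod_type, norm_mul, mul_pow, ← Finset.mul_sum, h, mul_one]
  refine le_of_eq_of_le ?_ ((norm_toLp_mulVec_le (colStack K) v).trans_eq (by rw [hv]))
  rw [← sq_eq_sq₀ (norm_nonneg _) (norm_nonneg _), EuclideanSpace.norm_sq_eq,
    EuclideanSpace.norm_sq_eq]
  let e : (α × β) × I × Fin d ≃ (α × β × Fin d) × I :=
    { toFun := fun t => ((t.1.1, t.1.2, t.2.2), t.2.1)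
      invFun := fun t => ((t.1.1, t.1.2.1), (t.2, t.1.2.2)) }
  refine Fintype.sum_equiv e _ _ fun t => congrArg (‖·‖ ^ 2) ?_
  simp only [mulVec, dotProduct, colStack, Matrix.of_apply, restrictState, e, Equiv.coe_fn_mk, v,
    Fintype.sum_prod_type, Finset.sum_mul]
  exact Finset.sum_congr rfl fun a _ => Finset.sum_congr rfl fun b _ =>
    Finset.sum_congr rfl fun k _ => by ring

theorem maximalValue_le : G.maximalValue ≤ traceNorm G.M ^ 2 := by
  refine iSup_le fun d => iSup_le fun φ => iSup_le fun T => iSup_le fun hφ => iSup_le fun hT => ?_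
  obtain ⟨m, K, rfl, hK⟩ := hT.exists_krausMap
  let W (y : Fin m × Fin d) : Matrix (α × β) (α × β) ℂ := restrictState φ (K y.1) y.2
  let t : EuclideanSpace ℂ (Fin m × Fin d) := toLp 2 fun y => (G.M * W y).trace
  have hW : ‖colStack W‖ ≤ 1 := (l2_opNorm_colStack_restrictState_le K hφ).trans hK
  have hwin : G.winProb (applyOn (jointSplit α β χ (Fin d)) (krausMap K)
      (pureState (tensorVec G.ψ φ))) = ‖t‖ ^ 2 := by
    simp only [winProb_krausMap, EuclideanSpace.norm_sq_eq, overlap_joint, t, W,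
      Fintype.sum_prod_type]
  have htrace : (G.M * ∑ y, star (t y) • W y).trace = ((‖t‖ ^ 2 : ℝ) : ℂ) := by
    rw [EuclideanSpace.norm_sq_eq]
    simp [Finset.mul_sum, trace_sum, t, RCLike.conj_mul]
  have hcomb : ‖∑ y, star (t y) • W y‖ ≤ ‖t‖ := by
    have hstar : ‖toLp 2 fun y => star (t y)‖ = ‖t‖ := by simp [EuclideanSpace.norm_eq]
    rw [← mul_one ‖t‖, ← hstar]
    exact (l2_opNorm_sum_smul_le (toLp 2 fun y => star (t y)) W).trans (by gcongr)
  have hle : ‖t‖ₑ ^ 2 ≤ traceNorm G.M * ‖t‖ₑ :=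
    calc ‖t‖ₑ ^ 2 = ‖(G.M * ∑ y, star (t y) • W y).trace‖ₑ := by
          rw [htrace, ← ofReal_norm, ← ofReal_norm, Complex.norm_real,
            Real.norm_of_nonneg (sq_nonneg _), ENNReal.ofReal_pow (norm_nonneg _)]
      _ ≤ traceNorm G.M * ‖∑ y, star (t y) • W y‖ₑ := enorm_trace_mul_le _ _
      _ ≤ traceNorm G.M * ‖t‖ₑ := by gcongr; exact enorm_le_iff_norm_le.mpr hcomb
  rw [hwin, ENNReal.ofReal_pow (norm_nonneg _), ofReal_norm]
  gcongr
  rcases eq_or_ne ‖t‖ₑ 0 with h0 | h0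
  · rw [h0]
    exact zero_le
  · rwa [sq, ENNReal.mul_le_mul_iff_left h0 enorm_ne_top] at hle

theorem le_maximalValue : traceNorm G.M ^ 2 ≤ G.maximalValue := by
  obtain ⟨W, hW, hWM⟩ := exists_enorm_trace_mul_eq_traceNorm G.M
  let e : α × β × Fin 1 ≃ α × β := (Equiv.prodAssoc α β (Fin 1)).symm.trans (Equiv.prodUnique _ _)
  obtain ⟨K, hK, hKq⟩ :=
    exists_isQuantumOperation_krausMap ((l2_opNorm_submatrix_equiv W e e).trans_le hW)
  let φ : EuclideanSpace ℂ (Fin 1) := EuclideanSpace.single 0 1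
  have hφ : ‖φ‖ = 1 := by simp [φ]
  have hrestrict : restrictState φ (K 0) 0 = W := by
    ext x y
    simp [restrictState, hK, e, φ]
  have hoverlap :
      ‖G.overlap (liftVec (jointSplit α β χ (Fin 1)) (K 0) (tensorVec G.ψ φ))‖ₑ =
        traceNorm G.M := by
    rw [← hWM, ← ofReal_norm, ← ofReal_norm, EuclideanSpace.norm_eq, Fin.sum_univ_one,
      Real.sqrt_sq (norm_nonneg _), overlap_joint, hrestrict]
  refine le_iSup_of_le 1 <| le_iSup_of_le φ <| le_iSup_of_le (krausMap K) <| le_iSup_of_le hφ <|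
    le_iSup_of_le hKq ?_
  rw [← hoverlap, ← ofReal_norm, ← ENNReal.ofReal_pow (norm_nonneg _)]
  exact ENNReal.ofReal_le_ofReal (G.norm_overlap_sq_le_winProb_krausMap ..)

end Game

end MaximalValue

/-! ### One-way communication -/

section HilbertSchmidt

variable {l m n : Type*} [Fintype l] [Fintype m] [Fintype n]

/-- The Hilbert–Schmidt norm of a rectangular matrix. -/
def hsNorm (X : Matrix m n ℂ) : ℝ := ‖toLp 2 (vec X)‖

theorem hsNorm_nonneg (X : Matrix m n ℂ) : 0 ≤ hsNorm X := norm_nonneg _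

theorem hsNorm_pos {X : Matrix m n ℂ} : 0 < hsNorm X ↔ X ≠ 0 := by
  simp [hsNorm]

theorem hsNorm_sq (X : Matrix m n ℂ) : hsNorm X ^ 2 = ∑ i, ∑ j, ‖X i j‖ ^ 2 := by
  simp only [hsNorm, EuclideanSpace.norm_sq_eq, Fintype.sum_prod_type_right, vec]

theorem hsNorm_sq_eq_trace (X : Matrix m n ℂ) :
    ((hsNorm X ^ 2 : ℝ) : ℂ) = (Xᴴ * X).trace := by
  rw [hsNorm_sq, Finset.sum_comm]
  simp [Matrix.trace, Matrix.mul_apply, Complex.conj_mul']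

theorem hsNorm_transpose (X : Matrix m n ℂ) : hsNorm Xᵀ = hsNorm X := by
  rw [← sq_eq_sq₀ (hsNorm_nonneg _) (hsNorm_nonneg _), hsNorm_sq, hsNorm_sq, Finset.sum_comm]
  rfl

theorem hsNorm_conjTranspose (X : Matrix m n ℂ) : hsNorm Xᴴ = hsNorm X := by
  rw [← hsNorm_transpose, ← sq_eq_sq₀ (hsNorm_nonneg _) (hsNorm_nonneg _), hsNorm_sq, hsNorm_sq]
  simp

theorem hsNorm_one_sq [DecidableEq m] : hsNorm (1 : Matrix m m ℂ) ^ 2 = Fintype.card m := by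
  simp [hsNorm_sq, Matrix.one_apply, apply_ite]

theorem hsNorm_mul_le (X : Matrix l m ℂ) (Y : Matrix m n ℂ) [DecidableEq n] :
    hsNorm (X * Y) ≤ hsNorm X * ‖Y‖ := by
  classical
  rw [hsNorm, vec_mul_eq_vecMul, ← mulVec_transpose, mul_comm]
  refine (norm_toLp_mulVec_le _ _).trans ?_
  rw [l2_opNorm_transpose, hsNorm]
  gcongr
  exact l2_opNorm_kronecker_one_le Y

theorem hsNorm_le_of_single_row [Unique l] [DecidableEq n] (R : Matrix l n ℂ) : hsNorm R ≤ ‖R‖ := by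
  have h := norm_toLp_mulVec_le Rᵀ (fun _ : l => (1 : ℂ))
  rw [l2_opNorm_transpose, EuclideanSpace.norm_eq (toLp 2 fun _ : l => (1 : ℂ))] at h
  refine le_of_eq_of_le ?_ (h.trans_eq (by simp))
  rw [← sq_eq_sq₀ (hsNorm_nonneg _) (norm_nonneg _), hsNorm_sq, EuclideanSpace.norm_sq_eq]
  simp [mulVec, dotProduct]

end HilbertSchmidt

section OneWayValue

variable {α β : Type*} [Fintype α] [Fintype β]

/-- The scalar pairing of `X ∈ B(ℂ^α) ⊗ B(ℂ^β)` with `x ⊗ y`. -/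
def pairing (X : Matrix (α × β) (α × β) ℂ) (x : Matrix α α ℂ) (y : Matrix β β ℂ) : ℂ :=
  ∑ a, ∑ a', ∑ b, ∑ b', X (a, b) (a', b') * (x a a' * y b b')

theorem pairing_smul_smul (X : Matrix (α × β) (α × β) ℂ) (s t : ℂ) (x : Matrix α α ℂ)
    (y : Matrix β β ℂ) : pairing X (s • x) (t • y) = s * t * pairing X x y := by
  simp only [pairing, Finset.mul_sum, Matrix.smul_apply, smul_eq_mul]
  refine Finset.sum_congr rfl fun a _ => Finset.sum_congr rfl fun a' _ =>
    Finset.sum_congr rfl fun b _ => Finset.sum_congr rfl fun b' _ => ?_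
  ring

namespace Game

variable {χ : Type*} [Fintype χ] (G : Game α β χ) {p : ℕ}

theorem overlap_oneWay (K : Matrix (α × Fin (p + 1)) (α × Fin (p + 1)) ℂ)
    (L : Matrix (β × Fin (p + 1)) (β × Fin (p + 1)) ℂ) (z : Fin (p + 1)) :
    G.overlap (liftVec (receiverSplit α β χ (Fin (p + 1))) L
      (liftVec (senderSplit α β χ (Fin (p + 1))) K
        (tensorVec G.ψ (EuclideanSpace.single (0 : Fin (p + 1)) (1 : ℂ))))) z =
    ∑ k, pairing G.M (Matrix.of fun a a' => K (a', k) (a, 0))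
      (Matrix.of fun b b' => L (b', z) (b, k)) := by
  have hinit (a' : α) (k : Fin (p + 1)) (b : β) (c : χ) : ∑ x : α × Fin (p + 1), K (a', k) x *
      (G.ψ (x.1, b, c) * (EuclideanSpace.single (0 : Fin (p + 1)) (1 : ℂ)) x.2) =
      ∑ a, K (a', k) (a, 0) * G.ψ (a, b, c) := by
    simp [Fintype.sum_prod_type]
  simp only [overlap, liftVec, receiverSplit, senderSplit, tensorVec, M, Matrix.of_apply, pairing,
    Equiv.coe_fn_mk, Equiv.coe_fn_symm_mk, hinit, Finset.mul_sum, Finset.sum_mul]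
  simp only [← Fintype.sum_prod_type']
  let e : (α × β × χ) × ((β × Fin (p + 1)) × α) ≃ Fin (p + 1) × α × α × β × β × χ :=
    { toFun := fun t => (t.2.1.2, t.2.2, t.1.1, t.2.1.1, t.1.2.1, t.1.2.2)
      invFun := fun t => ((t.2.2.1, t.2.2.2.2.1, t.2.2.2.2.2), (t.2.2.2.1, t.1), t.2.1) }
  refine Fintype.sum_equiv e _ _ fun t => ?_
  dsimp only [e, Equiv.coe_fn_mk]
  ring

variable [DecidableEq α] [DecidableEq β]

/-- The part of `krausBlock K` that acts when the register `A'` is initialized in `|0⟩`, as the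
block matrix of a map from `S_1^A` to row matrices. -/
def senderBlock {I : Type*} (K : I → Matrix (α × Fin (p + 1)) (α × Fin (p + 1)) ℂ) :
    Matrix (α × Unit) (α × (Fin (p + 1) × I)) ℂ :=
  (krausBlock K).submatrix (Prod.map id fun _ => 0) id

theorem isCompleteContraction_ofBlockMatrix_senderBlock {I : Type*} [Fintype I] [DecidableEq I]
    {K : I → Matrix (α × Fin (p + 1)) (α × Fin (p + 1)) ℂ} (h : ‖colStack K‖ ≤ 1) :
    IsCompleteContraction (s1Norms α) (ofBlockMatrix (senderBlock K)) := by
  refine isCompleteContraction_s1Norms_of_blockMatrix ?_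
  rw [blockMatrix_ofBlockMatrix]
  refine (l2_opNorm_submatrix_le _ (Function.injective_id.prodMap fun _ _ _ => rfl)
    Function.injective_id).trans ?_
  rwa [krausBlock, ← Equiv.coe_refl, l2_opNorm_submatrix_equiv, l2_opNorm_transpose]

theorem sum_norm_overlap_oneWay_sq_le {I J κ : Type*} [Fintype I] [Fintype J] [Fintype κ]
    [DecidableEq I] [DecidableEq J] [DecidableEq κ]
    (K : I → Matrix (α × Fin (p + 1)) (α × Fin (p + 1)) ℂ)
    (L : J → Matrix (β × Fin (p + 1)) (β × Fin (p + 1)) ℂ)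
    {a : κ → Matrix α α ℂ} {b : κ → Matrix β β ℂ} (hab : toTensor G.M = ∑ s, a s ⊗ₜ b s) :
    ∑ i, ∑ j, ‖G.overlap (liftVec (receiverSplit α β χ (Fin (p + 1))) (L j)
      (liftVec (senderSplit α β χ (Fin (p + 1))) (K i)
        (tensorVec G.ψ (EuclideanSpace.single (0 : Fin (p + 1)) (1 : ℂ)))))‖ ^ 2 ≤
    (‖rowStack fun s => ofBlockMatrix (senderBlock K) (a s)‖ *
      ‖colStack fun s => ofBlockMatrix (krausBlock L) (b s)‖) ^ 2 := by
  set R := rowStack fun s => ofBlockMatrix (senderBlock K) (a s)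
  set C := colStack fun s => ofBlockMatrix (krausBlock L) (b s)
  let A : Matrix I (Fin (p + 1) × κ) ℂ := Matrix.of fun i x => R () ((x.1, i), x.2)
  have hA : hsNorm A ≤ ‖R‖ := by
    refine le_of_eq_of_le ?_ (hsNorm_le_of_single_row R)
    rw [← sq_eq_sq₀ (hsNorm_nonneg _) (hsNorm_nonneg _), hsNorm_sq, hsNorm_sq]
    simp only [A, Matrix.of_apply, Fintype.sum_prod_type, Finset.univ_unique, Finset.sum_singleton]
    exact Finset.sum_comm
  have hoverlap (i : I) (z : Fin (p + 1)) (j : J) :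
      G.overlap (liftVec (receiverSplit α β χ (Fin (p + 1))) (L j)
        (liftVec (senderSplit α β χ (Fin (p + 1))) (K i)
          (tensorVec G.ψ (EuclideanSpace.single (0 : Fin (p + 1)) (1 : ℂ))))) z =
      (A * C) i (z, j) := by
    have hpair (k : Fin (p + 1)) : pairing G.M (Matrix.of fun a a' => K i (a', k) (a, 0))
        (Matrix.of fun b b' => L j (b', z) (b, k)) =
        rectTensorMap (ofBlockMatrix (senderBlock K)) (ofBlockMatrix (krausBlock L))
          (toTensor G.M) ((), k) ((k, i), (z, j)) := by
      rw [rectTensorMap_toTensor, blockMatrix_ofBlockMatrix, blockMatrix_ofBlockMatrix]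
      rfl
    simp only [overlap_oneWay, hpair, hab, map_sum, rectTensorMap_tmul, Matrix.sum_apply,
      Matrix.mul_apply, Fintype.sum_prod_type]
    rfl
  calc _ = hsNorm (A * C) ^ 2 := by
        simp only [hsNorm_sq, EuclideanSpace.norm_sq_eq, hoverlap, Fintype.sum_prod_type_right]
    _ ≤ (‖R‖ * ‖C‖) ^ 2 := by
        gcongr
        · exact hsNorm_nonneg _
        · exact (hsNorm_mul_le A C).trans (by gcongr)

theorem oneWayValue_le :
    G.oneWayValue ≤ haagerupNorm (s1Norms α) (s1Norms β) (toTensor G.M) ^ 2 := by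
  refine iSup_le fun p => iSup_le fun T => iSup_le fun S => iSup_le fun hT => iSup_le fun hS => ?_
  obtain ⟨m, K, rfl, hK⟩ := hT.exists_krausMap
  obtain ⟨n, L, rfl, hL⟩ := hS.exists_krausMap
  rw [← ENNReal.rpow_two, ← ENNReal.rpow_inv_le_iff two_pos]
  refine le_iInf fun k => le_iInf fun a => le_iInf fun b => le_iInf fun hab => ?_
  rw [ENNReal.rpow_inv_le_iff two_pos, ENNReal.rpow_two, winProb_krausMap_krausMap]
  refine (ENNReal.ofReal_le_ofReal (G.sum_norm_overlap_oneWay_sq_le K L hab)).trans ?_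
  rw [ENNReal.ofReal_pow (by positivity), ENNReal.ofReal_mul (norm_nonneg _), ofReal_norm,
    ofReal_norm]
  gcongr
  · exact enorm_rowStack_le_minNorm (isCompleteContraction_ofBlockMatrix_senderBlock hK) a
  · exact enorm_colStack_le_minNorm (isCompleteContraction_ofBlockMatrix_krausBlock hL) b

/-- Alice's operator sending `|a⟩|0⟩` to `∑ i, (x i)ᵀ |a⟩|i⟩`. -/
def senderOperator (x : Fin (p + 1) → Matrix α α ℂ) :
    Matrix (α × Fin (p + 1)) (α × Fin (p + 1)) ℂ :=
  Matrix.of fun s t => if t.2 = 0 then x s.2 t.1 s.1 else 0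

/-- Bob's operator sending `|b⟩|i⟩` to `(y i)ᵀ |b⟩|0⟩`. -/
def receiverOperator (y : Fin (p + 1) → Matrix β β ℂ) :
    Matrix (β × Fin (p + 1)) (β × Fin (p + 1)) ℂ :=
  Matrix.of fun s t => if s.2 = 0 then y t.2 t.1 s.1 else 0

theorem l2_opNorm_senderOperator_le (x : Fin (p + 1) → Matrix α α ℂ) :
    ‖senderOperator x‖ ≤ ‖rowStack x‖ := by
  have h : senderOperator x =
      (rowStack x)ᵀ * ((1 : Matrix (α × Fin (p + 1)) _ ℂ).submatrix id fun a : α =>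
        (a, (0 : Fin (p + 1))))ᴴ := by
    ext s t
    simp [senderOperator, rowStack, Matrix.mul_apply, Matrix.one_apply, Prod.ext_iff, ite_and,
      eq_comm (a := (0 : Fin (p + 1)))]
  rw [h]
  refine (l2_opNorm_mul _ _).trans ?_
  rw [l2_opNorm_transpose, l2_opNorm_conjTranspose]
  exact mul_le_of_le_one_right (norm_nonneg _)
    (l2_opNorm_one_submatrix_le fun _ _ h => (Prod.mk.inj h).1)

theorem l2_opNorm_receiverOperator_le (y : Fin (p + 1) → Matrix β β ℂ) :
    ‖receiverOperator y‖ ≤ ‖colStack y‖ := by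
  have h : receiverOperator y =
      (1 : Matrix (β × Fin (p + 1)) _ ℂ).submatrix id (fun b : β =>
        (b, (0 : Fin (p + 1)))) * (colStack y)ᵀ := by
    ext s t
    simp [receiverOperator, colStack, Matrix.mul_apply, Matrix.one_apply, Prod.ext_iff, ite_and]
  rw [h]
  refine (l2_opNorm_mul _ _).trans ?_
  rw [l2_opNorm_transpose]
  exact mul_le_of_le_one_left (norm_nonneg _)
    (l2_opNorm_one_submatrix_le fun _ _ h => (Prod.mk.inj h).1)

theorem enorm_sum_pairing_sq_le_oneWayValue {n : ℕ} {x : Fin n → Matrix α α ℂ}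
    {y : Fin n → Matrix β β ℂ} (hx : ‖rowStack x‖ ≤ 1) (hy : ‖colStack y‖ ≤ 1) :
    ‖∑ i, pairing G.M (x i) (y i)‖ₑ ^ 2 ≤ G.oneWayValue := by
  cases n with
  | zero => simp
  | succ p =>
    obtain ⟨K, hK, hKq⟩ :=
      exists_isQuantumOperation_krausMap ((l2_opNorm_senderOperator_le x).trans hx)
    obtain ⟨L, hL, hLq⟩ :=
      exists_isQuantumOperation_krausMap ((l2_opNorm_receiverOperator_le y).trans hy)
    refine le_iSup_of_le p <| le_iSup_of_le (krausMap K) <| le_iSup_of_le (krausMap L) <|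
      le_iSup_of_le hKq <| le_iSup_of_le hLq ?_
    have hoverlap : G.overlap (liftVec (receiverSplit α β χ (Fin (p + 1))) (L 0)
        (liftVec (senderSplit α β χ (Fin (p + 1))) (K 0)
          (tensorVec G.ψ (EuclideanSpace.single (0 : Fin (p + 1)) (1 : ℂ))))) 0 =
        ∑ i, pairing G.M (x i) (y i) := by
      rw [overlap_oneWay, hK, hL]
      rfl
    rw [← hoverlap, ← ofReal_norm, ← ENNReal.ofReal_pow (norm_nonneg _)]
    refine ENNReal.ofReal_le_ofReal (le_trans ?_
      (G.norm_overlap_sq_le_winProb_krausMap_krausMap _ _ K L _ 0 0))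
    gcongr
    exact PiLp.norm_apply_le _ _

end Game

end OneWayValue

/-! ### Duality for the Haagerup norm -/

section CStarAlgebra

variable {A : Type*} [CStarAlgebra A] [PartialOrder A] [StarOrderedRing A] {a : A} {r : ℝ}

theorem pos_of_norm_sub_smul_one_add_one_lt_one [Nontrivial A] (ha : 0 ≤ a)
    (h : ‖a - r • 1 + 1‖ < 1) : 0 < r := by
  by_contra! hr
  have hneg : 0 ≤ -(r • (1 : A)) := by
    rw [← neg_smul]
    exact smul_nonneg (neg_nonneg.mpr hr) zero_le_one
  have hle : (1 : A) ≤ a - r • 1 + 1 := by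
    rw [sub_eq_add_neg]
    exact le_add_of_nonneg_left (add_nonneg ha hneg)
  have := CStarAlgebra.norm_le_norm_of_nonneg_of_le zero_le_one hle
  rw [norm_one] at this
  exact absurd h this.not_gt

theorem norm_lt_of_norm_sub_smul_one_add_one_lt_one (ha : 0 ≤ a) (hr : 0 < r)
    (h : ‖a - r • 1 + 1‖ < 1) : ‖a‖ < r := by
  have hsa : IsSelfAdjoint (a - r • 1 + 1) :=
    ((IsSelfAdjoint.of_nonneg ha).sub ((IsSelfAdjoint.all r).smul (.one A))).add (.one A)
  have hle : a ≤ algebraMap ℝ A (max 0 (r - 1 + ‖a - r • 1 + 1‖)) := by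
    calc a = (a - r • 1 + 1) + algebraMap ℝ A (r - 1) := by
          rw [Algebra.algebraMap_eq_smul_one, sub_smul, one_smul]
          abel
      _ ≤ algebraMap ℝ A ‖a - r • 1 + 1‖ + algebraMap ℝ A (r - 1) := by
          gcongr
          exact hsa.le_algebraMap_norm_self
      _ ≤ algebraMap ℝ A (max 0 (r - 1 + ‖a - r • 1 + 1‖)) := by
          rw [← map_add, add_comm]
          exact algebraMap_mono A (le_max_right _ _)
  refine ((CStarAlgebra.norm_le_iff_le_algebraMap a (le_max_left _ _) ha).mpr hle).trans_lt ?_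
  exact max_lt hr (by linarith)

end CStarAlgebra

section Separation

variable {α β : Type*} [Fintype α] [Fintype β]

/-- The constraint `w (f (x xᴴ) + g (yᴴ y)) ≥ Re (pairing X x y)` on a pair of functionals `f`, `g`
with `f 1 + g 1 = 1`, as the element of `M_α × M_β` on which `(f, g)` has to be nonnegative. -/
def dualConstraint [DecidableEq α] [DecidableEq β] (X : Matrix (α × β) (α × β) ℂ) (w : ℝ)
    (x : Matrix α α ℂ) (y : Matrix β β ℂ) : Matrix α α ℂ × Matrix β β ℂ :=
  w • (x * xᴴ, yᴴ * y) - (pairing X x y).re • 1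

variable [DecidableEq α] [DecidableEq β] {X : Matrix (α × β) (α × β) ℂ} {w : ℝ}

theorem dualConstraint_sqrt_smul {c : ℝ} (hc : 0 ≤ c) (x : Matrix α α ℂ) (y : Matrix β β ℂ) :
    dualConstraint X w (((√c : ℝ) : ℂ) • x) (((√c : ℝ) : ℂ) • y) = c • dualConstraint X w x y := by
  have h : ((√c : ℝ) : ℂ) * ((√c : ℝ) : ℂ) = (c : ℂ) := by
    rw [← Complex.ofReal_mul, Real.mul_self_sqrt hc]
  simp only [dualConstraint, pairing_smul_smul, conjTranspose_smul, Matrix.smul_mul,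
    Matrix.mul_smul, smul_smul, Complex.re_ofReal_mul, smul_sub, Complex.star_def,
    Complex.conj_ofReal, h]
  rw [Complex.coe_smul, Complex.coe_smul, ← Prod.smul_mk, smul_smul, mul_comm w c]

variable (X w) in
/-- The convex cone generated by the dual constraints. A functional on `M_α × M_β` that is
positive on it is, up to normalization, a pair `(f, g)` satisfying all of them. -/
def constraintCone : ConvexCone ℝ (Matrix α α ℂ × Matrix β β ℂ) where
  carrier := {Z | ∃ (n : ℕ) (x : Fin n → Matrix α α ℂ) (y : Fin n → Matrix β β ℂ),
    Z = ∑ i, dualConstraint X w (x i) (y i)}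
  smul_mem' := by
    rintro c hc _ ⟨n, x, y, rfl⟩
    exact ⟨n, fun i => ((√c : ℝ) : ℂ) • x i, fun i => ((√c : ℝ) : ℂ) • y i,
      by simp only [dualConstraint_sqrt_smul hc.le, Finset.smul_sum]⟩
  add_mem' := by
    rintro _ ⟨m, x, y, rfl⟩ _ ⟨n, x', y', rfl⟩
    exact ⟨m + n, Fin.append x x', Fin.append y y', by simp [Fin.sum_univ_add]⟩

theorem dualConstraint_mem_constraintCone (x : Matrix α α ℂ) (y : Matrix β β ℂ) :
    dualConstraint X w x y ∈ constraintCone X w :=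
  ⟨1, fun _ => x, fun _ => y, by simp⟩

theorem sum_dualConstraint {n : ℕ} (x : Fin n → Matrix α α ℂ) (y : Fin n → Matrix β β ℂ) :
    ∑ i, dualConstraint X w (x i) (y i) =
      (w • ∑ i, x i * (x i)ᴴ - (∑ i, pairing X (x i) (y i)).re • 1,
        w • ∑ i, (y i)ᴴ * y i - (∑ i, pairing X (x i) (y i)).re • 1) := by
  ext1 <;> simp [dualConstraint, Prod.fst_sum, Prod.snd_sum, Finset.sum_sub_distrib,
    Finset.smul_sum, Finset.sum_smul]

variable (X w) in
/-- `w` strictly bounds the functional `x ⊗ y ↦ pairing X x y` on all pairs of a contractive row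
of matrices `x i` and a contractive column of matrices `y i`. -/
def IsStrictRowColumnBound : Prop :=
  ∀ (n : ℕ) (x : Fin n → Matrix α α ℂ) (y : Fin n → Matrix β β ℂ),
    ‖rowStack x‖ ≤ 1 → ‖colStack y‖ ≤ 1 → ‖∑ i, pairing X (x i) (y i)‖ < w

theorem IsStrictRowColumnBound.pos (hw : IsStrictRowColumnBound X w) : 0 < w := by
  have hx : ‖rowStack (0 : Fin 0 → Matrix α α ℂ)‖ ≤ 1 := by
    rw [Subsingleton.elim (rowStack _) 0, norm_zero]
    exact zero_le_one
  have hy : ‖colStack (0 : Fin 0 → Matrix β β ℂ)‖ ≤ 1 := by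
    rw [Subsingleton.elim (colStack _) 0, norm_zero]
    exact zero_le_one
  simpa using hw 0 0 0 hx hy

open scoped MatrixOrder in
theorem disjoint_ball_constraintCone [Nonempty α] (hw : IsStrictRowColumnBound X w) :
    Disjoint (Metric.ball (-1) 1) (constraintCone X w : Set (Matrix α α ℂ × Matrix β β ℂ)) := by
  have hw0 := hw.pos
  rw [Set.disjoint_left]
  rintro _ hZ ⟨n, x, y, rfl⟩
  rw [Metric.mem_ball, dist_eq_norm, sub_neg_eq_add, sum_dualConstraint, Prod.norm_def,
    max_lt_iff] at hZ
  set s := ∑ i, pairing X (x i) (y i)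
  have hS : 0 ≤ w • ∑ i, x i * (x i)ᴴ :=
    smul_nonneg hw0.le (Finset.sum_nonneg fun i _ => mul_star_self_nonneg (x i))
  have hS' : 0 ≤ w • ∑ i, (y i)ᴴ * y i :=
    smul_nonneg hw0.le (Finset.sum_nonneg fun i _ => star_mul_self_nonneg (y i))
  have hR : 0 < s.re := pos_of_norm_sub_smul_one_add_one_lt_one hS hZ.1
  have hx := norm_lt_of_norm_sub_smul_one_add_one_lt_one hS hR hZ.1
  have hy := norm_lt_of_norm_sub_smul_one_add_one_lt_one hS' hR hZ.2
  rw [norm_smul, Real.norm_of_nonneg hw0.le] at hx hy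
  have hc : ‖((√(w / s.re) : ℝ) : ℂ)‖ ^ 2 = w / s.re := by
    rw [Complex.norm_real, Real.norm_eq_abs, sq_abs, Real.sq_sqrt (by positivity)]
  have hle {t : ℝ} (ht : w * t < s.re) : w / s.re * t ≤ 1 := by
    rw [div_mul_eq_mul_div, div_le_one hR]
    exact ht.le
  have hlt := hw n (fun i => ((√(w / s.re) : ℝ) : ℂ) • x i) (fun i => ((√(w / s.re) : ℝ) : ℂ) • y i)
    (by
      rw [rowStack_smul, norm_smul, ← sq_le_one_iff₀ (by positivity), mul_pow, hc,
        l2_opNorm_rowStack_sq]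
      exact hle hx)
    (by
      rw [colStack_smul, norm_smul, ← sq_le_one_iff₀ (by positivity), mul_pow, hc,
        l2_opNorm_colStack_sq]
      exact hle hy)
  simp only [pairing_smul_smul, ← Finset.mul_sum] at hlt
  rw [norm_mul, norm_mul, ← sq, hc] at hlt
  have : w / s.re * s.re ≤ w / s.re * ‖s‖ := by
    gcongr
    exact Complex.re_le_norm s
  rw [div_mul_cancel₀ _ hR.ne'] at this
  exact this.not_gt hlt

theorem exists_dual_functional [Nonempty α] (hw : IsStrictRowColumnBound X w) :
    ∃ F : Matrix α α ℂ × Matrix β β ℂ →ₗ[ℝ] ℝ, 0 < F 1 ∧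
      ∀ x y, (pairing X x y).re * F 1 ≤ w * F (x * xᴴ, yᴴ * y) := by
  obtain ⟨F, u, hball, hcone⟩ := geometric_hahn_banach_open (convex_ball _ _) Metric.isOpen_ball
    (constraintCone X w).convex (disjoint_ball_constraintCone hw)
  have hu : u ≤ 0 := by simpa using hcone 0 ⟨0, 0, 0, by simp⟩
  have hF1 : 0 < F 1 := by
    have := hball (-1) (Metric.mem_ball_self one_pos)
    rw [map_neg] at this
    linarith
  refine ⟨F.toLinearMap, hF1, fun x y => ?_⟩
  have hnonneg : 0 ≤ F (dualConstraint X w x y) := by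
    by_contra! hneg
    have := hcone _ ((constraintCone X w).smul_mem
      (c := (u - 1) / F (dualConstraint X w x y)) (div_pos_of_neg_of_neg (by linarith) hneg)
      (dualConstraint_mem_constraintCone x y))
    rw [map_smul, smul_eq_mul, div_mul_cancel₀ _ hneg.ne] at this
    linarith
  rw [dualConstraint, map_sub, map_smul, map_smul, smul_eq_mul, smul_eq_mul] at hnonneg
  exact sub_nonneg.mp hnonneg

open scoped MatrixOrder in
theorem exists_positive_functionals [Nonempty α] (hw : IsStrictRowColumnBound X w) :
    ∃ (f : Matrix α α ℂ →ₗ[ℝ] ℝ) (g : Matrix β β ℂ →ₗ[ℝ] ℝ),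
      (∀ H, H.PosSemidef → 0 ≤ f H) ∧ (∀ H, H.PosSemidef → 0 ≤ g H) ∧ f 1 + g 1 = 2 * w ∧
      ∀ x y, 2 * (pairing X x y).re ≤ f (x * xᴴ) + g (yᴴ * y) := by
  obtain ⟨F, hF1, hF⟩ := exists_dual_functional hw
  have hw0 := hw.pos
  have hadd (H : Matrix α α ℂ) (H' : Matrix β β ℂ) : F (H, 0) + F (0, H') = F (H, H') := by
    rw [← map_add, Prod.mk_add_mk, add_zero, zero_add]
  refine ⟨(2 * w / F 1) • F ∘ₗ LinearMap.inl ℝ _ _, (2 * w / F 1) • F ∘ₗ LinearMap.inr ℝ _ _,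
    fun H hH => ?_, fun H hH => ?_, ?_, fun x y => ?_⟩
  · obtain ⟨x, rfl⟩ := CStarAlgebra.nonneg_iff_eq_mul_star_self.mp hH.nonneg
    have : 0 ≤ w * F (x * star x, 0) := by simpa [pairing, star_eq_conjTranspose] using hF x 0
    exact mul_nonneg (by positivity) (nonneg_of_mul_nonneg_right this hw0)
  · obtain ⟨y, rfl⟩ := CStarAlgebra.nonneg_iff_eq_star_mul_self.mp hH.nonneg
    have : 0 ≤ w * F (0, star y * y) := by simpa [pairing, star_eq_conjTranspose] using hF 0 y
    exact mul_nonneg (by positivity) (nonneg_of_mul_nonneg_right this hw0)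
  · simp only [LinearMap.smul_apply, LinearMap.comp_apply, LinearMap.inl_apply,
      LinearMap.inr_apply, smul_eq_mul]
    rw [← mul_add, hadd]
    exact div_mul_cancel₀ _ hF1.ne'
  · simp only [LinearMap.smul_apply, LinearMap.comp_apply, LinearMap.inl_apply,
      LinearMap.inr_apply, smul_eq_mul]
    rw [← mul_add, hadd, div_mul_eq_mul_div, le_div_iff₀ hF1]
    linarith [hF x y]

end Separation

section Density

variable {α : Type*} [Fintype α] {f : Matrix α α ℂ →ₗ[ℝ] ℝ}

theorem exists_re_trace_mul_eq (f : Matrix α α ℂ →ₗ[ℝ] ℝ) :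
    ∃ R : Matrix α α ℂ, ∀ X, (R * X).trace.re = f X := by
  classical
  let F : Module.Dual ℂ (Matrix α α ℂ) := Module.Dual.extendRCLike f
  refine ⟨Matrix.of fun b a => F (Matrix.single a b 1), fun X => ?_⟩
  have h : (Matrix.of (fun b a => F (Matrix.single a b 1)) * X).trace = F X := by
    conv_rhs => rw [Matrix.matrix_eq_sum_single X]
    simp only [Matrix.trace, Matrix.diag, Matrix.mul_apply, map_sum, Matrix.of_apply]
    rw [Finset.sum_comm]
    refine Finset.sum_congr rfl fun a _ => Finset.sum_congr rfl fun b _ => ?_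
    rw [← mul_one (X a b), ← smul_eq_mul (X a b) 1, ← smul_single, map_smul]
    simp [mul_comm]
  rw [h]
  exact Module.Dual.re_extendRCLike_apply (𝕜 := ℂ) f X

theorem exists_posSemidef_trace_mul_eq (hf : ∀ H, H.PosSemidef → 0 ≤ f H) :
    ∃ ρ : Matrix α α ℂ, ρ.PosSemidef ∧ ∀ H, H.IsHermitian → (ρ * H).trace = f H := by
  classical
  obtain ⟨R, hR⟩ := exists_re_trace_mul_eq f
  set ρ : Matrix α α ℂ := (2⁻¹ : ℂ) • (R + Rᴴ) with hρ
  have htrace (H : Matrix α α ℂ) (hH : H.IsHermitian) : (ρ * H).trace = f H := by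
    have h : (Rᴴ * H).trace = star (R * H).trace := by
      rw [← trace_conjTranspose, conjTranspose_mul, hH.eq, trace_mul_comm]
    rw [hρ, Matrix.smul_mul, trace_smul, add_mul, trace_add, h, ← hR H, Complex.star_def,
      Complex.add_conj]
    simp
  have hquad (v : α → ℂ) : star v ⬝ᵥ ρ *ᵥ v = f (vecMulVec v (star v)) := by
    rw [← htrace _ (posSemidef_vecMulVec_self_star v).1, mul_vecMulVec, trace_vecMulVec,
      dotProduct_comm]
  refine ⟨ρ, .of_dotProduct_mulVec_nonneg ?_ fun v => ?_, htrace⟩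
  · simp [IsHermitian, hρ, conjTranspose_smul, add_comm]
  · rw [hquad]
    exact_mod_cast hf _ (posSemidef_vecMulVec_self_star v)

open scoped MatrixOrder in
theorem exists_isUnit_hsNorm_mul_sq_eq [DecidableEq α] (hf : ∀ H, H.PosSemidef → 0 ≤ f H) {ε : ℝ}
    (hε : 0 < ε) :
    ∃ D : Matrix α α ℂ, IsUnit D ∧
      ∀ x : Matrix α α ℂ, hsNorm (D * x) ^ 2 = f (x * xᴴ) + ε * hsNorm x ^ 2 := by
  obtain ⟨ρ, hρ, hρf⟩ := exists_posSemidef_trace_mul_eq hf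
  have hpos : (ρ + (ε : ℂ) • 1).PosDef :=
    .posSemidef_add hρ (PosDef.one.smul (by exact_mod_cast hε))
  obtain ⟨D, hD⟩ := CStarAlgebra.nonneg_iff_eq_star_mul_self.mp hpos.posSemidef.nonneg
  refine ⟨D, isUnit_of_mul_isUnit_right (hD ▸ hpos.isUnit), fun x => ?_⟩
  have h : ((hsNorm (D * x) ^ 2 : ℝ) : ℂ) = f (x * xᴴ) + ε * (hsNorm x ^ 2 : ℝ) := by
    calc ((hsNorm (D * x) ^ 2 : ℝ) : ℂ) = ((ρ + (ε : ℂ) • 1) * (x * xᴴ)).trace := by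
          rw [hsNorm_sq_eq_trace, conjTranspose_mul, hD, star_eq_conjTranspose, Matrix.mul_assoc,
            trace_mul_comm]
          simp only [Matrix.mul_assoc]
      _ = f (x * xᴴ) + ε * (hsNorm x ^ 2 : ℝ) := by
          rw [add_mul, trace_add, hρf _ (isHermitian_mul_conjTranspose_self x), Matrix.smul_mul,
            Matrix.one_mul, trace_smul, trace_mul_comm, ← hsNorm_sq_eq_trace, smul_eq_mul]
  exact_mod_cast h

end Density

section Factorization

section Duality

variable {m n : Type*} [Fintype m] [Fintype n]

theorem l2_opNorm_le_one_of_re_dotProduct_le [DecidableEq n] {Λ : Matrix m n ℂ}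
    (h : ∀ u v, 2 * (u ⬝ᵥ Λ *ᵥ v).re ≤ ‖toLp 2 u‖ ^ 2 + ‖toLp 2 v‖ ^ 2) : ‖Λ‖ ≤ 1 := by
  refine l2_opNorm_le_of_forall_mulVec zero_le_one fun v => ?_
  have hre : (star (Λ *ᵥ v.ofLp) ⬝ᵥ Λ *ᵥ v.ofLp).re = ‖toLp 2 (Λ *ᵥ v.ofLp)‖ ^ 2 := by
    simp [dotProduct, EuclideanSpace.norm_sq_eq, Complex.conj_mul', ← Complex.ofReal_pow]
  have hstar : ‖toLp 2 (star (Λ *ᵥ v.ofLp))‖ = ‖toLp 2 (Λ *ᵥ v.ofLp)‖ := by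
    simp [EuclideanSpace.norm_eq]
  have := h (star (Λ *ᵥ v.ofLp)) v.ofLp
  rw [hre, hstar, WithLp.toLp_ofLp] at this
  rw [one_mul, ← sq_le_sq₀ (norm_nonneg _) (norm_nonneg _)]
  linarith

theorem exists_l2_opNorm_le_one_eq_mul_mul [DecidableEq m] [DecidableEq n] {M : Matrix m n ℂ}
    {P : Matrix m m ℂ} {Q : Matrix n n ℂ} (hP : IsUnit P) (hQ : IsUnit Q)
    (h : ∀ u v, 2 * (u ⬝ᵥ M *ᵥ v).re ≤ ‖toLp 2 (u ᵥ* P)‖ ^ 2 + ‖toLp 2 (Q *ᵥ v)‖ ^ 2) :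
    ∃ Λ : Matrix m n ℂ, ‖Λ‖ ≤ 1 ∧ M = P * Λ * Q := by
  rw [isUnit_iff_isUnit_det] at hP hQ
  refine ⟨P⁻¹ * M * Q⁻¹, l2_opNorm_le_one_of_re_dotProduct_le fun u v => ?_, ?_⟩
  · have := h (u ᵥ* P⁻¹) (Q⁻¹ *ᵥ v)
    rwa [vecMul_vecMul, nonsing_inv_mul _ hP, vecMul_one, mulVec_mulVec _ Q, mul_nonsing_inv _ hQ,
      one_mulVec, ← dotProduct_mulVec, mulVec_mulVec, mulVec_mulVec] at this
  · rw [← Matrix.mul_assoc, mul_nonsing_inv_cancel_left _ _ hP, nonsing_inv_mul_cancel_right _ _ hQ]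

end Duality

variable {α β : Type*}

/-- The matrix of the bilinear form `pairing X` in the coordinates `Matrix.vec`. -/
def reshuffle (X : Matrix (α × β) (α × β) ℂ) : Matrix (β × β) (α × α) ℂ :=
  Matrix.of fun y x => X (x.2, y.2) (x.1, y.1)

variable [Fintype α] [Fintype β] {X : Matrix (α × β) (α × β) ℂ}

theorem pairing_eq_dotProduct_reshuffle (X : Matrix (α × β) (α × β) ℂ) (x : Matrix α α ℂ)
    (y : Matrix β β ℂ) : pairing X x y = vec y ⬝ᵥ reshuffle X *ᵥ vec x := by
  simp only [pairing, dotProduct, mulVec, Finset.mul_sum]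
  rw [eq_comm, Finset.sum_comm]
  simp only [Fintype.sum_prod_type_right, reshuffle, vec, Matrix.of_apply]
  refine Finset.sum_congr rfl fun a _ => Finset.sum_congr rfl fun a' _ =>
    Finset.sum_congr rfl fun b _ => Finset.sum_congr rfl fun b' _ => ?_
  ring

variable [DecidableEq α] [DecidableEq β] {w w' : ℝ}

theorem exists_reshuffle_eq_mul_mul [Nonempty α] [Nonempty β] (hw : IsStrictRowColumnBound X w)
    (hww' : w < w') :
    ∃ (D : Matrix α α ℂ) (F : Matrix β β ℂ) (Λ : Matrix (β × β) (α × α) ℂ),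
      0 < hsNorm D ∧ 0 < hsNorm F ∧ hsNorm D ^ 2 + hsNorm F ^ 2 ≤ 2 * w' ∧ ‖Λ‖ ≤ 1 ∧
        reshuffle X = (F ⊗ₖ (1 : Matrix β β ℂ)) * Λ * ((1 : Matrix α α ℂ) ⊗ₖ D) := by
  obtain ⟨f, g, hf, hg, hfg, hX⟩ := exists_positive_functionals hw
  set N : ℝ := Fintype.card α + Fintype.card β
  have hN0 : 0 < N := by positivity
  set ε : ℝ := 2 * (w' - w) / N
  have hε0 : 0 < ε := div_pos (by linarith) hN0
  obtain ⟨D, hD, hDx⟩ := exists_isUnit_hsNorm_mul_sq_eq hf hε0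
  obtain ⟨E, hE, hEx⟩ := exists_isUnit_hsNorm_mul_sq_eq hg hε0
  have hEy (y : Matrix β β ℂ) : hsNorm (y * Eᴴ) ^ 2 = g (yᴴ * y) + ε * hsNorm y ^ 2 := by
    rw [← hsNorm_conjTranspose, conjTranspose_mul, conjTranspose_conjTranspose, hEx,
      conjTranspose_conjTranspose, hsNorm_conjTranspose]
  have hsum : hsNorm D ^ 2 + hsNorm Eᴴ ^ 2 = 2 * w' := by
    have h1 := hDx 1
    have h2 := hEy 1
    rw [Matrix.mul_one, conjTranspose_one, Matrix.mul_one, hsNorm_one_sq] at h1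
    rw [Matrix.one_mul, conjTranspose_one, Matrix.mul_one, hsNorm_one_sq] at h2
    have : ε * N = 2 * (w' - w) := div_mul_cancel₀ _ hN0.ne'
    linarith
  obtain ⟨Λ, hΛ, hXΛ⟩ := exists_l2_opNorm_le_one_eq_mul_mul (M := reshuffle X)
    (P := Eᴴ ⊗ₖ (1 : Matrix β β ℂ)) (Q := (1 : Matrix α α ℂ) ⊗ₖ D)
    (hE.star.kronecker isUnit_one) (isUnit_one.kronecker hD) fun u v => by
      obtain ⟨y, rfl⟩ := vec_bijective.surjective u
      obtain ⟨x, rfl⟩ := vec_bijective.surjective v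
      rw [← pairing_eq_dotProduct_reshuffle, ← vec_mul_eq_vecMul, ← vec_mul_eq_mulVec]
      change _ ≤ hsNorm (y * Eᴴ) ^ 2 + hsNorm (D * x) ^ 2
      rw [hEy, hDx]
      linarith [hX x y, mul_nonneg hε0.le (sq_nonneg (hsNorm x)),
        mul_nonneg hε0.le (sq_nonneg (hsNorm y))]
  exact ⟨D, Eᴴ, Λ, hsNorm_pos.mpr hD.ne_zero, hsNorm_pos.mpr hE.star.ne_zero, hsum.le, hΛ, hXΛ⟩

theorem toTensor_kronecker (a : Matrix α α ℂ) (b : Matrix β β ℂ) :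
    toTensor (a ⊗ₖ b) = a ⊗ₜ[ℂ] b := by
  conv_rhs => rw [matrix_eq_sum_single a, matrix_eq_sum_single b]
  simp only [TensorProduct.sum_tmul]
  simp only [toTensor, TensorProduct.tmul_sum, kroneckerMap_apply]
  refine Finset.sum_congr rfl fun i _ => Finset.sum_congr rfl fun j _ =>
    Finset.sum_congr rfl fun k _ => Finset.sum_congr rfl fun l _ => ?_
  rw [← TensorProduct.smul_tmul_smul, smul_single, smul_single, smul_eq_mul, smul_eq_mul, mul_one,
    mul_one]

theorem toTensor_sum {κ : Type*} [Fintype κ] (Y : κ → Matrix (α × β) (α × β) ℂ) :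
    toTensor (∑ i, Y i) = ∑ i, toTensor (Y i) :=
  map_sum (AddMonoidHom.mk' (toTensor (α := α) (β := β)) fun Y Z => by
    simp [toTensor, add_smul, Finset.sum_add_distrib]) Y Finset.univ

theorem toTensor_eq_sum_of_reshuffle_eq_mul_mul {D : Matrix α α ℂ} {F : Matrix β β ℂ}
    {Λ : Matrix (β × β) (α × α) ℂ}
    (h : reshuffle X = (F ⊗ₖ (1 : Matrix β β ℂ)) * Λ * ((1 : Matrix α α ℂ) ⊗ₖ D)) :
    toTensor X = ∑ k, (Dᵀ * Matrix.single k.2 k.1 1) ⊗ₜ[ℂ]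
      ∑ l, Λ l k • (Matrix.single l.2 l.1 1 * Fᵀ) := by
  have hD (k : α × α) (a a' : α) : (Dᵀ * Matrix.single k.2 k.1 (1 : ℂ)) a a' =
      ((1 : Matrix α α ℂ) ⊗ₖ D) k (a', a) := by
    simp [Matrix.mul_apply, Matrix.single_apply, Matrix.one_apply, ite_and, and_comm]
  have hF (l : β × β) (b b' : β) : (Matrix.single l.2 l.1 (1 : ℂ) * Fᵀ) b b' =
      (F ⊗ₖ (1 : Matrix β β ℂ)) (b', b) l := by
    simp [Matrix.mul_apply, Matrix.single_apply, Matrix.one_apply, ite_and, eq_comm]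
  have hX : X = ∑ k, (Dᵀ * Matrix.single k.2 k.1 1) ⊗ₖ
      ∑ l, Λ l k • (Matrix.single l.2 l.1 1 * Fᵀ) := by
    ext ⟨a, b⟩ ⟨a', b'⟩
    change reshuffle X (b', b) (a', a) = _
    rw [h, Matrix.mul_apply, Matrix.sum_apply]
    refine Finset.sum_congr rfl fun k _ => ?_
    change _ = (Dᵀ * Matrix.single k.2 k.1 1 : Matrix α α ℂ) a a' *
      (∑ l, Λ l k • (Matrix.single l.2 l.1 1 * Fᵀ) : Matrix β β ℂ) b b'
    rw [hD, Matrix.sum_apply, mul_comm, Matrix.mul_apply]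
    simp only [Matrix.smul_apply, hF, smul_eq_mul, mul_comm]
  simp_rw [← toTensor_kronecker, ← toTensor_sum, ← hX]

end Factorization

section HaagerupUpperBound

section TraceClass

variable {α P P' : Type*} [Fintype α]

theorem transpose_ofBlockMatrix (B : Matrix (α × P) (α × P') ℂ) (c : Matrix α α ℂ) :
    (ofBlockMatrix B c)ᵀ = ofBlockMatrix Bᵀ cᵀ := by
  ext p q
  exact Finset.sum_comm

variable [Fintype P] [Fintype P'] [DecidableEq α] [DecidableEq P']

theorem l2_opNorm_colStack_ofBlockMatrix_le (B : Matrix (α × P) (α × P') ℂ) (F : Matrix α α ℂ) :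
    ‖colStack fun l : α × α => ofBlockMatrix B (Matrix.single l.2 l.1 1 * Fᵀ)‖ ≤
      ‖B‖ * hsNorm F := by
  let e : P × (α × α) ≃ (α × P) × α :=
    ⟨fun x => ((x.2.2, x.1), x.2.1), fun y => (y.1.2, y.2, y.1.1), fun _ => rfl, fun _ => rfl⟩
  let e' : P' × (α × α) ≃ (α × P') × α :=
    ⟨fun x => ((x.2.2, x.1), x.2.1), fun y => (y.1.2, y.2, y.1.1), fun _ => rfl, fun _ => rfl⟩
  have h : (colStack fun l : α × α => ofBlockMatrix B (Matrix.single l.2 l.1 1 * Fᵀ)) =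
      (B ⊗ₖ (1 : Matrix α α ℂ)).submatrix e e' *
        colStack fun x => vec F x • (1 : Matrix P' P' ℂ) := by
    ext ⟨p, l, s⟩ q
    simp [colStack, ofBlockMatrix, e, e', Matrix.mul_apply, Matrix.one_apply, Matrix.single_apply,
      Fintype.sum_prod_type, ite_and, mul_comm]
  rw [h]
  refine (l2_opNorm_mul _ _).trans ?_
  rw [l2_opNorm_submatrix_equiv]
  gcongr
  · exact l2_opNorm_kronecker_one_le B
  · exact l2_opNorm_colStack_smul_one_le (toLp 2 (vec F))

theorem l2_opNorm_rowStack_ofBlockMatrix_le (B : Matrix (α × P) (α × P') ℂ) (D : Matrix α α ℂ) :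
    ‖rowStack fun k : α × α => ofBlockMatrix B (Dᵀ * Matrix.single k.2 k.1 1)‖ ≤
      hsNorm D * ‖B‖ := by
  classical
  have h (k : α × α) : ofBlockMatrix B (Dᵀ * Matrix.single k.2 k.1 1) =
      (ofBlockMatrix Bᵀ (Matrix.single k.1 k.2 1 * (Dᵀ)ᵀ))ᵀ := by
    rw [transpose_ofBlockMatrix, transpose_transpose, transpose_mul, transpose_transpose,
      transpose_single]
  simp only [h, l2_opNorm_rowStack_transpose]
  calc _ = ‖colStack fun l : α × α => ofBlockMatrix Bᵀ (Matrix.single l.2 l.1 1 * (Dᵀ)ᵀ)‖ :=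
        l2_opNorm_colStack_comp_equiv _ (Equiv.prodComm α α)
    _ ≤ ‖Bᵀ‖ * hsNorm Dᵀ := l2_opNorm_colStack_ofBlockMatrix_le _ _
    _ = hsNorm D * ‖B‖ := by rw [l2_opNorm_transpose, hsNorm_transpose, mul_comm]

end TraceClass

theorem haagerupNorm_toTensor_le {α β : Type*} [Fintype α] [Fintype β] [DecidableEq α]
    [DecidableEq β] [Nonempty α] [Nonempty β] {X : Matrix (α × β) (α × β) ℂ} {w w' : ℝ}
    (hw : IsStrictRowColumnBound X w) (hww' : w < w') :
    haagerupNorm (s1Norms α) (s1Norms β) (toTensor X) ≤ ENNReal.ofReal w' := by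
  obtain ⟨D, F, Λ, hD, hF, hDF, hΛ, hX⟩ := exists_reshuffle_eq_mul_mul hw hww'
  have hrow (q : ℕ) (T : Matrix α α ℂ →ₗ[ℂ] Matrix (Fin q) (Fin q) ℂ)
      (hT : IsCompleteContraction (s1Norms α) T) :
      ‖rowStack fun k : α × α => T (Dᵀ * Matrix.single k.2 k.1 1)‖ ≤ hsNorm D := by
    have := l2_opNorm_rowStack_ofBlockMatrix_le (blockMatrix T) D
    rw [ofBlockMatrix_blockMatrix] at this
    exact this.trans (mul_le_of_le_one_right hD.le hT.norm_blockMatrix_le)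
  have hcol (q : ℕ) (S : Matrix β β ℂ →ₗ[ℂ] Matrix (Fin q) (Fin q) ℂ)
      (hS : IsCompleteContraction (s1Norms β) S) :
      ‖colStack fun k : α × α => S (∑ l, Λ l k • (Matrix.single l.2 l.1 1 * Fᵀ))‖ ≤ hsNorm F := by
    simp only [map_sum, map_smul]
    calc _ ≤ ‖Λᵀ‖ * ‖colStack fun l : β × β => S (Matrix.single l.2 l.1 1 * Fᵀ)‖ :=
          l2_opNorm_colStack_sum_smul_le Λᵀ _
      _ ≤ 1 * (1 * hsNorm F) := by
          gcongr
          · rwa [l2_opNorm_transpose]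
          · have := l2_opNorm_colStack_ofBlockMatrix_le (blockMatrix S) F
            rw [ofBlockMatrix_blockMatrix] at this
            exact this.trans (by gcongr; exact hS.norm_blockMatrix_le)
      _ = hsNorm F := by rw [one_mul, one_mul]
  refine (haagerupNorm_le (toTensor_eq_sum_of_reshuffle_eq_mul_mul hX) hD hF hrow hcol).trans
    (ENNReal.ofReal_le_ofReal ?_)
  linarith [two_mul_le_add_sq (hsNorm D) (hsNorm F)]

theorem Game.le_oneWayValue {α β χ : Type*} [Fintype α] [Fintype β] [Fintype χ] [DecidableEq α]
    [DecidableEq β] (G : Game α β χ) :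
    haagerupNorm (s1Norms α) (s1Norms β) (toTensor G.M) ^ 2 ≤ G.oneWayValue := by
  obtain ⟨⟨a, b, -⟩⟩ : Nonempty (α × β × χ) := by
    by_contra h
    rw [not_nonempty_iff] at h
    simpa [Subsingleton.elim G.ψ 0] using G.norm_ψ
  have : Nonempty α := ⟨a⟩
  have : Nonempty β := ⟨b⟩
  rw [sq_le_iff_le_rpow_inv_two]
  refine le_of_forall_gt_imp_ge_of_dense fun c hc => ?_
  obtain rfl | hctop := eq_or_ne c ⊤
  · exact le_top
  obtain ⟨d, hd, hdc⟩ := exists_between hc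
  rw [← ENNReal.ofReal_toReal hctop]
  refine haagerupNorm_toTensor_le (w := d.toReal) (fun n x y hx hy => ?_)
    ((ENNReal.toReal_lt_toReal hdc.ne_top hctop).mpr hdc)
  have h := (sq_le_iff_le_rpow_inv_two.mp
    (G.enorm_sum_pairing_sq_le_oneWayValue hx hy)).trans_lt hd
  rw [← ofReal_norm] at h
  exact (ENNReal.ofReal_lt_iff_lt_toReal (norm_nonneg _) hdc.ne_top).mp h

end HaagerupUpperBound

end RankOneGames

end

theorem mainTheorem3 {α β χ : Type*} [Fintype α] [Fintype β] [Fintype χ]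
    [DecidableEq α] [DecidableEq β] (G : RankOneGames.Game α β χ) :
    G.entangledValue =
        RankOneGames.minNorm (RankOneGames.s1Norms α) (RankOneGames.s1Norms β)
          (RankOneGames.toTensor G.M) ^ 2 ∧
      G.oneWayValue =
        RankOneGames.haagerupNorm (RankOneGames.s1Norms α) (RankOneGames.s1Norms β)
          (RankOneGames.toTensor G.M) ^ 2 ∧
      G.maximalValue = RankOneGames.traceNorm G.M ^ 2 :=
  ⟨le_antisymm G.entangledValue_le G.le_entangledValue,
    le_antisymm G.oneWayValue_le G.le_oneWayValue,
    le_antisymm G.maximalValue_le G.le_maximalValue⟩
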